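/- Let $X$ be a separable complete metric space with metric $\rho$ and let $T\colon X\to X$ be continuous. **Strong approximate product structure (SAPS).** A specification is a finite sequence $\xi=(\langle x_j,n_j\rangle)_{j=1}^k$, $k\ge 1$, with $x_j\in X$ and integers $n_j\ge 1$. A point $y\in X$ $(\varepsilon,\delta_1,\delta_2)$-approximately traces $\xi$ if $\rho(T^t(x_1),T^t(y))<\varepsilon$ for $0\le t<n_1$, and there are integers $s_1,\dots,s_{k-1}\ge 0$ such that for each $2\le j\le k$ one has $s_{j-1}\le\delta_2 n_j$ and there is a set $\Lambda_j\subseteq\{0,\dots,n_j-1\}$ with $|\Lambda_j|\ge(1-\delta_1)n_j$ and $$\rho\bigl(T^t(x_j),\,T^{t+\sum_{i=1}^{j-1}(n_i+s_i)}(y)\bigr)<\varepsilon\quad\text{for all }t\in\Lambda_j .$$ $(X,T)$ has SAPS if for all $\varepsilon,\delta_1,\delta_2>0$ there is an integer $N\ge 0$ such that every specification with $n_j\ge N$ for all $j$ is $(\varepsilon,\delta_1,\delta_2)$-approximately traced by some point of $X$. **Generic points.** Let $\mathcal M(X)$ be the space of Borel probability measures on $X$ with the topology of weak convergence, and $\mathcal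 M_T(X)$ the set of $T$-invariant ones. For $x\in X$ and $n\ge1$ let $\mathcal E(x,n)=\frac1n\sum_{i=0}^{n-1}\delta_{T^i(x)}$, and let $V(x)\subseteq\mathcal M(X)$ be the set of limit points of the sequence $(\mathcal E(x,n))_{n\ge1}$ (the limits of its convergent subsequences). For $\mu\in\mathcal M_T(X)$ put $G_\mu=\{x:\mathcal E(x,n)\to\mu\}$, and for $V,U\subseteq\mathcal M(X)$ put $G^V=\{x: V\subseteq V(x)\}$, $G_V=\{x: V(x)\subseteq V\}$, $G(V)=G^V\cap G_V$, and ${}^{U}G=\{x:V(x)\cap U\ne\emptyset\}$. **Complexity.** $\boldsymbol\Sigma^0_1$ is the class of open sets, $\boldsymbol\Pi^0_n$ consists of the complements of $\boldsymbol\Sigma^0_n$ sets, and $\boldsymbol\Sigma^0_n$ for $n\ge2$ consists of the countable unions $\bigcup_i A_i$ with each $A_i\in\boldsymbol\Pi^0_{m_i}$ for some $1\le m_i<n$. A set $A\subseteq X$ is $\boldsymbol\Sigma^0_n$-hard if $A\notin\boldsymbol\Pi^0_n$, is $\boldsymbol\Pi^0_n$-hard if $A\notin\boldsymbol\Sigma^0_n$,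 and is $\boldsymbol\Pi^0_n$-complete if $A\in\boldsymbol\Pi^0_n\setminus\boldsymbol\Sigma^0_n$. **Theorem.** Suppose that $(X,T)$ has the strong approximate product structure. (i) If $|\mathcal M_T(X)|\ge 2$, then for every $\mu\in\mathcal M_T(X)$ the set $G_\mu$ is $\boldsymbol\Pi^0_3$-complete. (ii) For every nonempty closed connected set $V\subseteq\mathcal M_T(X)$ with nonempty complement $U=\mathcal M_T(X)\setminus V$, the sets $G_V$ and $G(V)$ are $\boldsymbol\Pi^0_3$-hard, the set ${}^{U}G$ is $\boldsymbol\Sigma^0_3$-hard, and the set $G^V$ is $\boldsymbol\Pi^0_2$-complete. Moreover, the sets $G_V$, $G^V$, $G(V)$ and ${}^{U}G$ are all dense in $X$. -/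

import Mathlib

open Set Filter Topology MeasureTheory

noncomputable section

namespace PolishDyn

/-! ### The finite levels of the Borel hierarchy -/

/-- `IsSigma0 n A`: the set `A` belongs to the (boldface) class `Σ⁰ₙ`, for `n ≥ 1`. The class
`Σ⁰₁` consists of the open sets, and `Σ⁰ₙ` of the countable unions `⋃ i, A i` in which each
`A i` is in `Π⁰` of some level `m i < n`, i.e. has its complement in `Σ⁰` of that level. -/
inductive IsSigma0 {X : Type*} [TopologicalSpace X] : ℕ → Set X → Prop
  | isOpen (A : Set X) (hA : IsOpen A) : IsSigma0 1 A
  | iUnion (n : ℕ) (m : ℕ → ℕ) (A : ℕ → Set X) (hm : ∀ i, 1 ≤ m i ∧ m i < n)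
      (hA : ∀ i, IsSigma0 (m i) (A i)ᶜ) : IsSigma0 n (⋃ i, A i)

/-- The class `Π⁰ₙ`: complements of `Σ⁰ₙ` sets. -/
def IsPi0 {X : Type*} [TopologicalSpace X] (n : ℕ) (A : Set X) : Prop :=
  IsSigma0 n Aᶜ

/-- `A` is `Σ⁰ₙ`-hard: it is not a `Π⁰ₙ` set. -/
def IsSigma0Hard {X : Type*} [TopologicalSpace X] (n : ℕ) (A : Set X) : Prop :=
  ¬ IsPi0 n A

/-- `A` is `Π⁰ₙ`-hard: it is not a `Σ⁰ₙ` set. -/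
def IsPi0Hard {X : Type*} [TopologicalSpace X] (n : ℕ) (A : Set X) : Prop :=
  ¬ IsSigma0 n A

/-- `A` is `Π⁰ₙ`-complete: it is a `Π⁰ₙ` set and it is `Π⁰ₙ`-hard. -/
def IsPi0Complete {X : Type*} [TopologicalSpace X] (n : ℕ) (A : Set X) : Prop :=
  IsPi0 n A ∧ IsPi0Hard n A

/-! ### The strong approximate product structure -/

/-- The Bowen ball of radius `ε` around `x` along the finite set `Λ` of times. -/
def bowenBall {X : Type*} [MetricSpace X] (T : X → X) (Λ : Finset ℕ) (x : X) (ε : ℝ) : Set X :=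
  {y | ∀ t ∈ Λ, dist (T^[t] x) (T^[t] y) < ε}

/-- The point `y` `(ε, δ₁, δ₂)`-approximately-traces the specification `ξ`, a sequence of
`k + 1` orbit segments `ξ j = (x_j, n_j)`, `0 ≤ j ≤ k`. The gap between the segments `j` and
`j + 1` is `s j`, so that the tracing of the segment `j + 1` starts at the time
`∑ i ≤ j, (n_i + s_i)`. -/
def ApproxTraces {X : Type*} [MetricSpace X] (T : X → X) (ε δ₁ δ₂ : ℝ) {k : ℕ}
    (ξ : Fin (k + 1) → X × ℕ+) (y : X) : Prop :=
  y ∈ bowenBall T (Finset.range (ξ 0).2) (ξ 0).1 ε ∧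
  ∃ s : Fin k → ℕ, ∀ j : Fin k,
    (s j : ℝ) ≤ δ₂ * ((ξ j.succ).2 : ℕ) ∧
    ∃ Λ : Finset ℕ, Λ ⊆ Finset.range (ξ j.succ).2 ∧
      (1 - δ₁) * ((ξ j.succ).2 : ℕ) ≤ (Λ.card : ℝ) ∧
      T^[∑ i ∈ Finset.Iic j, (((ξ i.castSucc).2 : ℕ) + s i)] y ∈
        bowenBall T Λ (ξ j.succ).1 ε

/-- The strong approximate product structure of `(X, T)` (for the given metric of `X`). -/
def HasSAPS {X : Type*} [MetricSpace X] (T : X → X) : Prop :=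
  ∀ ε δ₁ δ₂ : ℝ, 0 < ε → 0 < δ₁ → 0 < δ₂ →
    ∃ N : ℕ, ∀ (k : ℕ) (ξ : Fin (k + 1) → X × ℕ+), (∀ j, N ≤ ((ξ j).2 : ℕ)) →
      ∃ y : X, ApproxTraces T ε δ₁ δ₂ ξ y

/-! ### Invariant measures and statistical behaviour of orbits

`ProbabilityMeasure X` carries the topology of weak convergence. -/

/-- The set of `T`-invariant Borel probability measures. -/
def invMeasures {X : Type*} [MeasurableSpace X] (T : X → X) : Set (ProbabilityMeasure X) :=
  {μ | MeasurePreserving T (μ : Measure X) (μ : Measure X)}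

/-- The empirical measure `(1/n) (δ_x + δ_{T x} + ⋯ + δ_{T^{n-1} x})`. -/
def emp {X : Type*} [MeasurableSpace X] (T : X → X) (x : X) (n : ℕ+) : ProbabilityMeasure X :=
  ⟨((n : ℕ) : ENNReal)⁻¹ • ∑ i ∈ Finset.range n, Measure.dirac (T^[i] x), ⟨by
    simp only [Measure.smul_apply, Measure.finsetSum_apply, measure_univ, Finset.sum_const,
      Finset.card_range, nsmul_eq_mul, mul_one, smul_eq_mul]
    exact ENNReal.inv_mul_cancel (by simp) (by simp)⟩⟩

/-- The set `G_μ` of `μ`-generic points. -/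
def genericPts {X : Type*} [MetricSpace X] [MeasurableSpace X] [BorelSpace X] (T : X → X)
    (μ : ProbabilityMeasure X) : Set X :=
  {x | Tendsto (fun n : ℕ => emp T x n.succPNat) atTop (𝓝 μ)}

/-- The set `V(x)` of limit points of the sequence of empirical measures of `x`. -/
def limitMeasures {X : Type*} [MetricSpace X] [MeasurableSpace X] [BorelSpace X] (T : X → X)
    (x : X) : Set (ProbabilityMeasure X) :=
  {μ | MapClusterPt μ atTop (fun n : ℕ => emp T x n.succPNat)}

/-- `G^V`, the set of points `x` with `V ⊆ V(x)`. -/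
def upperG {X : Type*} [MetricSpace X] [MeasurableSpace X] [BorelSpace X] (T : X → X)
    (V : Set (ProbabilityMeasure X)) : Set X :=
  {x | V ⊆ limitMeasures T x}

/-- `G_V`, the set of points `x` with `V(x) ⊆ V`. -/
def lowerG {X : Type*} [MetricSpace X] [MeasurableSpace X] [BorelSpace X] (T : X → X)
    (V : Set (ProbabilityMeasure X)) : Set X :=
  {x | limitMeasures T x ⊆ V}

/-- `G(V) = G^V ∩ G_V`, the set of generic points for `V`. -/
def genericG {X : Type*} [MetricSpace X] [MeasurableSpace X] [BorelSpace X] (T : X → X)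
    (V : Set (ProbabilityMeasure X)) : Set X :=
  upperG T V ∩ lowerG T V

/-- `^U G`, the set of points `x` for which `V(x)` meets `U`. -/
def meetG {X : Type*} [MetricSpace X] [MeasurableSpace X] [BorelSpace X] (T : X → X)
    (U : Set (ProbabilityMeasure X)) : Set X :=
  {x | (limitMeasures T x ∩ U).Nonempty}

end PolishDyn

end

/-!
Integrating bounded `1`-Lipschitz functions embeds the space of probability measures into a Banach
space `E` and sends the empirical measures of `x` to the Birkhoff averages of an `E`-valued function
along the orbit of `x`. By the law of large numbers the image of every invariant measure is a limit
of averages over independently chosen orbit segments, so the tracing property lets one prolong any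
orbit segment in such a way that its averages move almost straight towards any prescribed invariant
measure. Prolonging infinitely often yields, continuously in the sequence of targets, points whose
averages follow that sequence.

Let `V` be closed and connected. A sequence in `V` that moves in ever smaller steps and accumulates
at every point of `V` may be chosen to return infinitely often to a measure `v ∈ V` which is a limit
of invariant measures `e k ∉ V`; such a `v` exists because the invariant measures form a convex,
hence connected, set. Replace the `j`-th target by `e (α j)` whenever it is `v`. If `α` tends to
infinity, the resulting point is generic for `V`; if `α` takes some value `k` at infinitely many of
these `j`, then `e k ∉ V` is one of its limit measures. By a Baire category argument no countable
union of `Gδ` sets separates these two kinds of `α`, while `Σ⁰₃` sets are such unions.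
-/

noncomputable section

namespace PolishDyn

open BoundedContinuousFunction

/-! ### The bounded Lipschitz embedding of the space of probability measures -/

section Integral

variable {X E : Type*} [MetricSpace X] [TopologicalSpace.SeparableSpace X] [MeasurableSpace X]
  [BorelSpace X] [NormedAddCommGroup E]

lemma memLp_boundedContinuous (μ : Measure X) [IsFiniteMeasure μ] (p : ENNReal) (F : X →ᵇ E) :
    MemLp F p μ := by
  borelize E
  have : SecondCountableTopology X := UniformSpace.secondCountable_of_separable X
  exact MemLp.of_bound F.continuous.stronglyMeasurable.aestronglyMeasurable ‖F‖
    (Eventually.of_forall F.norm_coe_le_norm)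

lemma integrable_boundedContinuous (μ : Measure X) [IsFiniteMeasure μ] (F : X →ᵇ E) :
    Integrable F μ :=
  memLp_one_iff_integrable.1 (memLp_boundedContinuous μ 1 F)

variable [NormedSpace ℝ E]

lemma exists_eLpNorm_smul_const_sub_indicator_le (μ : Measure X) [IsFiniteMeasure μ] (c : E)
    {s : Set X} (hs : MeasurableSet s) {δ : ENNReal} (hδ : δ ≠ 0) :
    ∃ h : X →ᵇ ℝ, eLpNorm ((fun x => h x • c) - s.indicator fun _ => c) 1 μ ≤ δ := by
  obtain ⟨h, hh, -⟩ := ((memLp_const (μ := μ) (p := 1) (1 : ℝ)).indicator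
    hs).exists_boundedContinuous_eLpNorm_sub_le ENNReal.one_ne_top
    (ε := δ / ‖c‖ₑ) (ENNReal.div_ne_zero.2 ⟨hδ, enorm_ne_top⟩)
  refine ⟨h, ?_⟩
  calc eLpNorm ((fun x => h x • c) - s.indicator fun _ => c) 1 μ
      ≤ ‖c‖ₑ * eLpNorm (s.indicator (fun _ => (1 : ℝ)) - ⇑h) 1 μ := by
        refine eLpNorm_le_mul_eLpNorm_of_ae_le_mul' (c := ‖c‖₊) (Eventually.of_forall fun x => ?_) 1
        have : h x • c - s.indicator (fun _ => c) x =
            -((s.indicator (fun _ => (1 : ℝ)) x - h x) • c) := by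
          by_cases hx : x ∈ s <;> simp [hx, sub_smul]
        rw [Pi.sub_apply, Pi.sub_apply, this, enorm_neg, enorm_smul, mul_comm]
        rfl
    _ ≤ ‖c‖ₑ * (δ / ‖c‖ₑ) := by gcongr
    _ ≤ δ := ENNReal.mul_div_le

variable [CompleteSpace E]

lemma exists_integral_norm_sub_le_continuous_integral (μ : Measure X) [IsFiniteMeasure μ]
    (F : X →ᵇ E) {ε : ℝ} (hε : 0 < ε) :
    ∃ G : X →ᵇ E, ∫ x, ‖F x - G x‖ ∂μ ≤ ε ∧
      Continuous fun ν : ProbabilityMeasure X => ∫ x, G x ∂(ν : Measure X) := by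
  let P (g : X → E) : Prop := ∃ G : X →ᵇ E, G = g ∧
    Continuous fun ν : ProbabilityMeasure X => ∫ x, G x ∂(ν : Measure X)
  suffices H : ∃ g, eLpNorm (⇑F - g) 1 μ ≤ ENNReal.ofReal ε ∧ P g by
    obtain ⟨_, hG, G, rfl, hGc⟩ := H
    refine ⟨G, ?_, hGc⟩
    rw [eLpNorm_one_eq_lintegral_enorm] at hG
    rw [← ENNReal.ofReal_le_ofReal_iff hε.le]
    exact (ofReal_integral_norm_eq_lintegral_enorm
      (integrable_boundedContinuous μ (F - G))).trans_le hG
  refine MemLp.induction_dense ENNReal.one_ne_top P (fun c s hs _ δ hδ => ?_) ?_ ?_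
    (memLp_boundedContinuous μ 1 F) (ENNReal.ofReal_pos.2 hε).ne'
  · obtain ⟨h, hh⟩ := exists_eLpNorm_smul_const_sub_indicator_le μ c hs hδ
    refine ⟨_, hh, h • BoundedContinuousFunction.const X c, rfl, ?_⟩
    exact ((ProbabilityMeasure.continuous_integral_boundedContinuousFunction h).smul
      continuous_const).congr fun ν => (integral_smul_const h c).symm
  · rintro _ _ ⟨G₁, rfl, h₁⟩ ⟨G₂, rfl, h₂⟩
    refine ⟨G₁ + G₂, rfl, ?_⟩
    exact (h₁.add h₂).congr fun ν => (integral_add (integrable_boundedContinuous _ G₁)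
      (integrable_boundedContinuous _ G₂)).symm
  · rintro _ ⟨G, rfl, -⟩
    exact (memLp_boundedContinuous μ 1 G).aestronglyMeasurable

theorem continuous_integral_boundedContinuous (F : X →ᵇ E) :
    Continuous fun μ : ProbabilityMeasure X => ∫ x, F x ∂(μ : Measure X) := by
  rw [continuous_iff_continuousAt]
  intro μ
  rw [ContinuousAt, Metric.tendsto_nhds]
  intro ε hε
  obtain ⟨G, hFG, hG⟩ := exists_integral_norm_sub_le_continuous_integral (μ : Measure X) F
    (show 0 < ε / 4 by positivity)
  let D : X →ᵇ ℝ := BoundedContinuousFunction.normComp (F - G)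
  have hD (ν : ProbabilityMeasure X) :
      dist (∫ x, F x ∂(ν : Measure X)) (∫ x, G x ∂(ν : Measure X)) ≤ ∫ x, D x ∂(ν : Measure X) := by
    rw [dist_eq_norm, ← integral_sub (integrable_boundedContinuous _ F)
      (integrable_boundedContinuous _ G)]
    exact norm_integral_le_integral_norm _
  have hDμ : ∫ x, D x ∂(μ : Measure X) < ε / 3 := hFG.trans_lt (by linarith)
  have hDν := (ProbabilityMeasure.continuous_integral_boundedContinuousFunction D).continuousAt
    (x := μ) |>.eventually_lt_const hDμ
  filter_upwards [hDν, (Metric.tendsto_nhds.1 (hG.tendsto μ)) (ε / 3) (by positivity)]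
    with ν hν hGν
  calc dist (∫ x, F x ∂(ν : Measure X)) (∫ x, F x ∂(μ : Measure X))
      ≤ dist (∫ x, F x ∂(ν : Measure X)) (∫ x, G x ∂(ν : Measure X)) +
          dist (∫ x, G x ∂(ν : Measure X)) (∫ x, G x ∂(μ : Measure X)) +
          dist (∫ x, G x ∂(μ : Measure X)) (∫ x, F x ∂(μ : Measure X)) := dist_triangle4 _ _ _ _
    _ < ε := by
        have h₁ := hD ν
        have h₂ := hD μ
        rw [dist_comm] at h₂
        linarith

end Integral

section Embedding

variable {X : Type*} [MetricSpace X]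

/-- The unit ball of the space of bounded Lipschitz functions. -/
abbrev LipBall (X : Type*) [MetricSpace X] : Type _ :=
  {f : X →ᵇ ℝ // LipschitzWith 1 f ∧ ‖f‖ ≤ 1}

/-- The evaluation functional `f ↦ f x` on `LipBall X`. It sends the points of `X`, and by
averaging the probability measures on `X`, into a single Banach space. -/
def lipEval (x : X) : LipBall X →ᵇ ℝ :=
  BoundedContinuousFunction.ofNormedAddCommGroup (fun f => f.1 x)
    ((evalCLM ℝ x).continuous.comp continuous_subtype_val) 1
    (fun f => (f.1.norm_coe_le_norm x).trans f.2.2)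

lemma norm_lipEval_le (x : X) : ‖lipEval x‖ ≤ 1 :=
  norm_ofNormedAddCommGroup_le _ zero_le_one _

lemma lipschitzWith_lipEval : LipschitzWith 1 (lipEval (X := X)) :=
  LipschitzWith.of_dist_le_mul fun x y =>
    (dist_le (by positivity)).2 fun f => f.2.1.dist_le_mul x y

/-- `lipEval` as a bounded continuous map. -/
def lipEvalBCF (X : Type*) [MetricSpace X] : X →ᵇ (LipBall X →ᵇ ℝ) :=
  BoundedContinuousFunction.ofNormedAddCommGroup lipEval lipschitzWith_lipEval.continuous 1
    norm_lipEval_le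

variable [MeasurableSpace X]

/-- The functional `f ↦ ∫ f dμ` on `LipBall X`: the barycentre of the evaluation functionals. -/
def lipMean (μ : ProbabilityMeasure X) : LipBall X →ᵇ ℝ := ∫ x, lipEval x ∂(μ : Measure X)

variable [BorelSpace X] [TopologicalSpace.SeparableSpace X]

lemma integrable_lipEval (μ : Measure X) [IsFiniteMeasure μ] : Integrable (lipEval (X := X)) μ :=
  integrable_boundedContinuous μ (lipEvalBCF X)

lemma continuous_lipMean : Continuous (lipMean (X := X)) :=
  continuous_integral_boundedContinuous (lipEvalBCF X)

lemma lipMean_apply (μ : ProbabilityMeasure X) (f : LipBall X) :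
    lipMean μ f = ∫ x, f.1 x ∂(μ : Measure X) :=
  ((evalCLM ℝ f : (LipBall X →ᵇ ℝ) →L[ℝ] ℝ).integral_comp_comm
    (integrable_lipEval (μ : Measure X))).symm

omit [MeasurableSpace X] [BorelSpace X] [TopologicalSpace.SeparableSpace X] in
lemma exists_mul_lipBall_eq {f : X → ℝ} {C : ℝ} {K : NNReal} (hC : ∀ x, |f x| ≤ C)
    (hK : LipschitzWith K f) : ∃ (c : ℝ) (g : LipBall X), ∀ x, f x = c * g.1 x := by
  let c : ℝ := max (max C K) 1
  have hc : 0 < c := one_pos.trans_le (le_max_right _ _)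
  have hKc : (K : ℝ) ≤ c := (le_max_right _ _).trans (le_max_left _ _)
  have hCc : C ≤ c := (le_max_left _ _).trans (le_max_left _ _)
  have hbound (x : X) : ‖c⁻¹ * f x‖ ≤ 1 := by
    rw [norm_mul, Real.norm_of_nonneg (inv_pos.2 hc).le, inv_mul_le_iff₀ hc, mul_one]
    exact (hC x).trans hCc
  have hlip : LipschitzWith 1 fun x => c⁻¹ * f x := LipschitzWith.of_dist_le_mul fun x y => by
    rw [Real.dist_eq, ← mul_sub, abs_mul, abs_of_pos (inv_pos.2 hc), inv_mul_le_iff₀ hc,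
      NNReal.coe_one, one_mul, ← Real.dist_eq]
    exact (hK.dist_le_mul x y).trans (by gcongr)
  refine ⟨c, ⟨BoundedContinuousFunction.ofNormedAddCommGroup _ hlip.continuous 1 hbound, hlip,
    norm_ofNormedAddCommGroup_le _ zero_le_one _⟩, fun x => ?_⟩
  simp [hc.ne']

theorem isInducing_lipMean : IsInducing (lipMean (X := X)) := by
  rw [isInducing_iff_nhds]
  intro μ
  refine le_antisymm (continuous_lipMean.tendsto μ).le_comap (tendsto_id'.1 ?_)
  rw [tendsto_iff_forall_lipschitz_integral_tendsto]
  rintro f ⟨C, hC⟩ ⟨K, hK⟩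
  have x₀ : X := μ.nonempty.some
  have hbound (x : X) : |f x| ≤ |f x₀| + C := by
    have := abs_sub_abs_le_abs_sub (f x) (f x₀)
    have := hC x x₀
    rw [Real.dist_eq] at this
    linarith
  obtain ⟨c, g, hg⟩ := exists_mul_lipBall_eq hbound hK
  have hint (ν : ProbabilityMeasure X) : c * lipMean ν g = ∫ x, f x ∂(ν : Measure X) := by
    simp only [lipMean_apply, hg, integral_const_mul]
  simp only [← hint, id]
  exact (((evalCLM ℝ g).continuous.tendsto (lipMean μ)).comp tendsto_comap).const_mul c

lemma isSeparable_range_lipMean : TopologicalSpace.IsSeparable (range (lipMean (X := X))) := by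
  refine ((TopologicalSpace.isSeparable_range lipschitzWith_lipEval.continuous).span
    (R := ℝ)).closure.mono ?_
  rintro _ ⟨μ, rfl⟩
  exact Convex.integral_mem (Submodule.convex _).closure isClosed_closure
    (Eventually.of_forall fun x => subset_closure (Submodule.subset_span ⟨x, rfl⟩))
    (integrable_lipEval _)

lemma lipMean_emp (T : X → X) (x : X) (n : ℕ+) :
    lipMean (emp T x n) = birkhoffAverage ℝ T lipEval n x := by
  change ∫ y, lipEval y ∂(((n : ℕ) : ENNReal)⁻¹ • ∑ i ∈ Finset.range n,
    Measure.dirac (T^[i] x)) = _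
  rw [integral_smul_measure, integral_finsetSum_measure fun i _ => integrable_lipEval _]
  simp [birkhoffAverage, birkhoffSum, integral_dirac]

end Embedding

section LawOfLargeNumbers

variable {X E : Type*} [NormedAddCommGroup E] [NormedSpace ℝ E]

/-- The vector `m` is a limit of averages of the sums of `f` over orbit segments of any
prescribed length. -/
def IsOrbitApproximable (T : X → X) (f : X → E) (m : E) : Prop :=
  ∀ n : ℕ, ∃ x : ℕ → X, Tendsto
    (fun J : ℕ => (J : ℝ)⁻¹ • ∑ i ∈ Finset.range J, birkhoffSum T f n (x i)) atTop (𝓝 (n • m))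

lemma IsOrbitApproximable.sub_const {T : X → X} {f : X → E} {m : E}
    (h : IsOrbitApproximable T f m) (c : E) :
    IsOrbitApproximable T (fun x => f x - c) (m - c) := by
  intro n
  obtain ⟨x, hx⟩ := h n
  refine ⟨x, ?_⟩
  rw [smul_sub]
  refine (hx.sub_const (n • c)).congr' ?_
  filter_upwards [eventually_ne_atTop 0] with J hJ
  have hJ' : (J : ℝ) ≠ 0 := Nat.cast_ne_zero.2 hJ
  simp [birkhoffSum, Finset.sum_sub_distrib, smul_sub, ← Nat.cast_smul_eq_nsmul ℝ J,
    inv_smul_smul₀ hJ']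

variable [MeasurableSpace X]

lemma integral_birkhoffSum {T : X → X} {μ : Measure X} (hT : MeasurePreserving T μ μ) {f : X → E}
    (hfm : StronglyMeasurable f) (hf : Integrable f μ) (n : ℕ) :
    ∫ x, birkhoffSum T f n x ∂μ = n • ∫ x, f x ∂μ := by
  have hint (t : ℕ) : ∫ x, f (T^[t] x) ∂μ = ∫ x, f x ∂μ := by
    conv_rhs => rw [← (hT.iterate t).map_eq]
    rw [integral_map (hT.iterate t).measurable.aemeasurable hfm.aestronglyMeasurable]
  have hi (t : ℕ) : Integrable (fun x => f (T^[t] x)) μ :=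
    (hT.iterate t).integrable_comp_of_integrable hf
  simp only [birkhoffSum]
  rw [integral_finsetSum _ fun t _ => hi t]
  simp [hint]

variable [CompleteSpace E]

lemma exists_seq_tendsto_average_integral (μ : Measure X) [IsProbabilityMeasure μ] {g : X → E}
    (hgm : StronglyMeasurable g) (hg : Integrable g μ) :
    ∃ x : ℕ → X, Tendsto (fun J : ℕ => (J : ℝ)⁻¹ • ∑ i ∈ Finset.range J, g (x i)) atTop
      (𝓝 (∫ x, g x ∂μ)) := by
  borelize E
  let P : Measure (ℕ → X) := Measure.infinitePi fun _ => μ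
  have heval (i : ℕ) : MeasurePreserving (fun ω : ℕ → X => ω i) P μ :=
    measurePreserving_eval_infinitePi _ i
  have hident (i : ℕ) : ProbabilityTheory.IdentDistrib (fun ω : ℕ → X => g (ω i))
      (fun ω => g (ω 0)) P P :=
    (ProbabilityTheory.IdentDistrib.mk (heval i).measurable.aemeasurable
      (heval 0).measurable.aemeasurable
      ((heval i).map_eq.trans (heval 0).map_eq.symm)).comp hgm.measurable
  have hindep : ProbabilityTheory.iIndepFun (fun i (ω : ℕ → X) => g (ω i)) P :=
    ProbabilityTheory.iIndepFun_infinitePi fun _ => hgm.measurable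
  obtain ⟨x, hx⟩ := (ProbabilityTheory.strong_law_ae (fun i (ω : ℕ → X) => g (ω i))
    ((heval 0).integrable_comp_of_integrable hg) (fun i j hij => hindep.indepFun hij)
    hident).exists
  have hint : ∫ ω : ℕ → X, g (ω 0) ∂P = ∫ x, g x ∂μ := by
    rw [← (heval 0).map_eq, integral_map (heval 0).measurable.aemeasurable
      hgm.aestronglyMeasurable]
  exact ⟨x, hint ▸ hx⟩

lemma isOrbitApproximable_integral {T : X → X} {μ : Measure X} [IsProbabilityMeasure μ]
    (hT : MeasurePreserving T μ μ) {f : X → E} (hfm : StronglyMeasurable f)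
    (hf : Integrable f μ) : IsOrbitApproximable T f (∫ x, f x ∂μ) := by
  intro n
  rw [← integral_birkhoffSum hT hfm hf]
  exact exists_seq_tendsto_average_integral μ
    (Finset.stronglyMeasurable_fun_sum _ fun t _ =>
      hfm.comp_measurable (hT.iterate t).measurable)
    (integrable_finsetSum _ fun t _ => (hT.iterate t).integrable_comp_of_integrable hf)

end LawOfLargeNumbers

lemma isOrbitApproximable_lipMean {X : Type*} [MetricSpace X] [MeasurableSpace X] [BorelSpace X]
    [TopologicalSpace.SeparableSpace X] {T : X → X} {μ : ProbabilityMeasure X}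
    (hμ : μ ∈ invMeasures T) : IsOrbitApproximable T lipEval (lipMean μ) := by
  borelize (LipBall X →ᵇ ℝ)
  have : SecondCountableTopology X := UniformSpace.secondCountable_of_separable X
  exact isOrbitApproximable_integral hμ lipschitzWith_lipEval.continuous.stronglyMeasurable
    (integrable_lipEval _)

/-! ### Tracing concatenations of long orbit segments -/

lemma norm_birkhoffSum_le {X E : Type*} [NormedAddCommGroup E] {T : X → X} {f : X → E} {K : ℝ}
    (hK : ∀ x, ‖f x‖ ≤ K) (n : ℕ) (x : X) : ‖birkhoffSum T f n x‖ ≤ K * n :=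
  (norm_sum_le_of_le _ fun _ _ => hK _).trans (by simp [mul_comm])

section Distance

variable {X E : Type*} [MetricSpace X] [NormedAddCommGroup E] {T : X → X} {f : X → E} {C : NNReal}
  {K : ℝ}

lemma dist_birkhoffSum_le_of_trace {ε : ℝ} (hfC : LipschitzWith C f) {x y : X} {n : ℕ}
    (h : ∀ t < n, dist (T^[t] x) (T^[t] y) ≤ ε) :
    dist (birkhoffSum T f n x) (birkhoffSum T f n y) ≤ C * ε * n := by
  refine (dist_birkhoffSum_birkhoffSum_le T f n x y).trans ?_
  refine (Finset.sum_le_card_nsmul _ _ (C * ε) fun t ht => ?_).trans (by simp [mul_comm])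
  exact (hfC.dist_le_mul _ _).trans
    (mul_le_mul_of_nonneg_left (h t (Finset.mem_range.1 ht)) C.2)

lemma dist_birkhoffSum_le_of_approxTrace {ε : ℝ} (hε : 0 ≤ ε) (hfC : LipschitzWith C f)
    (hfK : ∀ x, ‖f x‖ ≤ K) {x y : X} {n : ℕ} {Λ : Finset ℕ} (hΛ : Λ ⊆ Finset.range n)
    (hcard : (1 - ε) * n ≤ Λ.card) (h : ∀ t ∈ Λ, dist (T^[t] x) (T^[t] y) < ε) :
    dist (birkhoffSum T f n x) (birkhoffSum T f n y) ≤ (C + 2 * K) * ε * n := by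
  have hK : 0 ≤ K := (norm_nonneg _).trans (hfK x)
  have hgood : ∑ t ∈ Λ, dist (f (T^[t] x)) (f (T^[t] y)) ≤ C * ε * n := by
    refine (Finset.sum_le_card_nsmul Λ _ (C * ε) fun t ht => (hfC.dist_le_mul _ _).trans
      (mul_le_mul_of_nonneg_left (h t ht).le C.2)).trans ?_
    rw [nsmul_eq_mul, mul_comm]
    have : (Λ.card : ℝ) ≤ n := by simpa using Nat.cast_le (α := ℝ).2 (Finset.card_le_card hΛ)
    gcongr
  have hbad : ∑ t ∈ Finset.range n \ Λ, dist (f (T^[t] x)) (f (T^[t] y)) ≤ 2 * K * (ε * n) := by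
    refine (Finset.sum_le_card_nsmul _ _ (2 * K) fun t _ => ?_).trans ?_
    · refine (dist_le_norm_add_norm _ _).trans ?_
      linarith [hfK (T^[t] x), hfK (T^[t] y)]
    · rw [nsmul_eq_mul, mul_comm, Finset.cast_card_sdiff hΛ, Finset.card_range]
      gcongr
      linarith
  calc dist (birkhoffSum T f n x) (birkhoffSum T f n y)
      ≤ ∑ t ∈ Finset.range n, dist (f (T^[t] x)) (f (T^[t] y)) :=
        dist_birkhoffSum_birkhoffSum_le T f n x y
    _ ≤ (C + 2 * K) * ε * n := by
        rw [← Finset.sum_sdiff hΛ]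
        linarith

end Distance

section Tracing

variable {X E : Type*} [MetricSpace X] {T : X → X}

/-- The point `z` traces, within `ε`, the orbit segment of length `N` of `y` and then, up to gaps
and errors of relative size `ε`, segments of length `n` of the orbits of `x 0, …, x (k - 1)`.
The time at which the tracing of the `j`-th of these starts is `b j` plus a gap, and
`b (j + 1)` is the time at which it ends. -/
structure BlockTraces (T : X → X) (ε : ℝ) (y : X) (N : ℕ) (x : ℕ → X) (n k : ℕ) (z : X)
    (b : ℕ → ℕ) : Prop where
  zero : b 0 = N
  dist_lt : ∀ t < N, dist (T^[t] y) (T^[t] z) < ε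
  succ : ∀ j < k, ∃ s : ℕ, s ≤ ε * n ∧ b (j + 1) = b j + s + n ∧
    ∃ Λ ⊆ Finset.range n, (1 - ε) * n ≤ (Λ.card : ℝ) ∧
      ∀ t ∈ Λ, dist (T^[t] (x j)) (T^[t] (T^[b j + s] z)) < ε

lemma HasSAPS.exists_blockTraces (h : HasSAPS T) {ε : ℝ} (hε : 0 < ε) :
    ∃ N₀ : ℕ, ∀ (y : X) (x : ℕ → X) (N n k : ℕ), 0 < N → 0 < n → N₀ ≤ N → N₀ ≤ n →
      ∃ z b, BlockTraces T ε y N x n k z b := by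
  obtain ⟨N₀, hN₀⟩ := h ε ε ε hε hε hε
  refine ⟨N₀, fun y x N n k hN hn hNN hNn => ?_⟩
  let ξ : Fin (k + 1) → X × ℕ+ := Fin.cons (y, ⟨N, hN⟩) fun j => (x j, ⟨n, hn⟩)
  obtain ⟨z, hz, s, hs⟩ := hN₀ k ξ (fun j => by
    cases j using Fin.cases with
    | zero => exact hNN
    | succ j => exact hNn)
  let gap (j : ℕ) : ℕ := if hj : j < k then s ⟨j, hj⟩ else 0
  have hgap (j : Fin k) : gap j = s j := by simp [gap]
  let b (j : ℕ) : ℕ := N + ∑ i ∈ Finset.range j, (gap i + n)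
  have hb (j : ℕ) : b (j + 1) = b j + gap j + n := by
    simp only [b, Finset.sum_range_succ, add_assoc]
  have hstart (j : Fin k) :
      ∑ i ∈ Finset.Iic j, (((ξ i.castSucc).2 : ℕ) + s i) = b j + s j := by
    have hsum (j : ℕ) : ∑ i ∈ Finset.range (j + 1), ((if i = 0 then N else n) + gap i) =
        b j + gap j := by
      induction j with
      | zero => simp [b]
      | succ j ih => rw [Finset.sum_range_succ, ih, hb, if_neg j.succ_ne_zero]; ring
    rw [← hgap, ← hsum, Nat.range_succ_eq_Iic, ← Fin.map_valEmbedding_Iic, Finset.sum_map]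
    refine Finset.sum_congr rfl fun i _ => ?_
    rw [Fin.valEmbedding_apply, hgap]
    rcases i with ⟨_ | i, hi⟩ <;> rfl
  refine ⟨z, b, by simp [b], fun t ht => hz t (Finset.mem_range.2 ht), fun j hj => ?_⟩
  obtain ⟨hsj, Λ, hΛ, hcard, hdist⟩ := hs ⟨j, hj⟩
  rw [hstart] at hdist
  exact ⟨s ⟨j, hj⟩, hsj, by rw [hb, hgap ⟨j, hj⟩], Λ, hΛ, hcard, hdist⟩

namespace BlockTraces

variable {ε : ℝ} {y z : X} {x : ℕ → X} {N n k : ℕ} {b : ℕ → ℕ}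

lemma add_mul_le (h : BlockTraces T ε y N x n k z b) {j : ℕ} (hj : j ≤ k) : N + n * j ≤ b j := by
  induction j with
  | zero => simp [h.zero]
  | succ j ih =>
    obtain ⟨s, -, hb, -⟩ := h.succ j hj
    have := ih (Nat.le_of_succ_le hj)
    rw [hb, Nat.mul_succ]
    omega

lemma exists_mem_block (h : BlockTraces T ε y N x n k z b) (hε : ε ≤ 1) {i : ℕ} (hi : N ≤ i)
    {j : ℕ} (hj : j ≤ k) (hij : i ≤ b j) : ∃ l ≤ k, b l ≤ i ∧ i ≤ b l + 2 * n := by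
  induction j with
  | zero => exact ⟨0, hj, h.zero.trans_le hi, by omega⟩
  | succ j ih =>
    rcases le_or_gt i (b j) with hij' | hij'
    · exact ih (Nat.le_of_succ_le hj) hij'
    · obtain ⟨s, hs, hb, -⟩ := h.succ j hj
      have hsn : s ≤ n := by
        exact_mod_cast hs.trans (mul_le_of_le_one_left (Nat.cast_nonneg n) hε)
      exact ⟨j, Nat.le_of_succ_le hj, hij'.le, by omega⟩

variable [NormedAddCommGroup E] {f : X → E} {C : NNReal} {K : ℝ}

lemma dist_birkhoffSum_succ_le (h : BlockTraces T ε y N x n k z b) (hε : 0 ≤ ε)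
    (hfC : LipschitzWith C f) (hfK : ∀ x, ‖f x‖ ≤ K) {j : ℕ} (hj : j < k) :
    dist (birkhoffSum T f (b (j + 1)) z) (birkhoffSum T f (b j) z + birkhoffSum T f n (x j)) ≤
      (C + 3 * K) * ε * n := by
  obtain ⟨s, hs, hb, Λ, hΛ, hcard, hdist⟩ := h.succ j hj
  have hK : 0 ≤ K := (norm_nonneg _).trans (hfK z)
  have hgap : ‖birkhoffSum T f s (T^[b j] z)‖ ≤ K * (ε * n) :=
    (norm_birkhoffSum_le hfK _ _).trans (by gcongr)
  have hblock := dist_birkhoffSum_le_of_approxTrace hε hfC hfK hΛ hcard hdist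
  rw [dist_comm, dist_eq_norm] at hblock
  rw [hb, birkhoffSum_add, birkhoffSum_add, add_assoc, dist_add_left, dist_eq_norm, add_sub_assoc]
  calc _ ≤ K * (ε * n) + (C + 2 * K) * ε * n := norm_add_le_of_le hgap hblock
    _ = (C + 3 * K) * ε * n := by ring

lemma dist_birkhoffSum_le (h : BlockTraces T ε y N x n k z b) (hε : 0 ≤ ε)
    (hfC : LipschitzWith C f) (hfK : ∀ x, ‖f x‖ ≤ K) {j : ℕ} (hj : j ≤ k) :
    dist (birkhoffSum T f (b j) z)
      (birkhoffSum T f N y + ∑ l ∈ Finset.range j, birkhoffSum T f n (x l)) ≤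
      (C + 3 * K) * ε * (N + n * j) := by
  have hK : 0 ≤ K := (norm_nonneg _).trans (hfK z)
  induction j with
  | zero =>
    have := dist_birkhoffSum_le_of_trace hfC fun t ht => (h.dist_lt t ht).le
    rw [h.zero, dist_comm]
    simp only [Finset.range_zero, Finset.sum_empty, add_zero, Nat.cast_zero, mul_zero]
    exact this.trans (by gcongr; linarith)
  | succ j ih =>
    rw [Finset.sum_range_succ, ← add_assoc]
    have hlast := h.dist_birkhoffSum_succ_le hε hfC hfK hj
    have hprev := ih (Nat.le_of_succ_le hj)
    rw [← dist_add_right _ _ (birkhoffSum T f n (x j))] at hprev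
    refine (dist_triangle _ _ _).trans ((add_le_add hlast hprev).trans_eq ?_)
    push_cast
    ring

lemma norm_birkhoffSum_le_add (h : BlockTraces T ε y N x n k z b) (hε : 0 ≤ ε) (hε₁ : ε ≤ 1)
    (hn : 0 < n) (hfC : LipschitzWith C f) (hfK : ∀ x, ‖f x‖ ≤ K) {D : ℝ}
    (hD : ∀ J : ℕ, ‖∑ l ∈ Finset.range J, birkhoffSum T f n (x l)‖ ≤ ε * J + D)
    {i : ℕ} (hi : i ∈ Icc N (b k)) :
    ‖birkhoffSum T f i z‖ ≤
      ‖birkhoffSum T f N y‖ + (C + 3 * K + 1) * ε * i + (D + K * (2 * n)) := by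
  obtain ⟨j, hj, hbi, hib⟩ := h.exists_mem_block hε₁ hi.1 le_rfl hi.2
  have hK : 0 ≤ K := (norm_nonneg _).trans (hfK z)
  have hpartial : ‖birkhoffSum T f (i - b j) (T^[b j] z)‖ ≤ K * (2 * n) := by
    refine (norm_birkhoffSum_le hfK _ _).trans ?_
    have : ((i - b j : ℕ) : ℝ) ≤ 2 * n := by exact_mod_cast (by omega : i - b j ≤ 2 * n)
    gcongr
  have htrace := h.dist_birkhoffSum_le hε hfC hfK hj
  rw [dist_eq_norm] at htrace
  have hNji : (N : ℝ) + n * j ≤ i := by exact_mod_cast (h.add_mul_le hj).trans hbi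
  have hji : (j : ℝ) ≤ i := by
    have : (j : ℝ) ≤ n * j := by exact_mod_cast Nat.le_mul_of_pos_left j hn
    linarith [Nat.cast_nonneg (α := ℝ) N]
  have hblocks : ‖birkhoffSum T f (b j) z‖ ≤ ‖birkhoffSum T f N y‖ + (ε * j + D) +
      (C + 3 * K) * ε * (N + n * j) := by
    linarith [norm_le_norm_add_norm_sub' (birkhoffSum T f (b j) z)
      (birkhoffSum T f N y + ∑ l ∈ Finset.range j, birkhoffSum T f n (x l)),
      norm_add_le (birkhoffSum T f N y) (∑ l ∈ Finset.range j, birkhoffSum T f n (x l)), hD j]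
  have hsplit : birkhoffSum T f i z =
      birkhoffSum T f (b j) z + birkhoffSum T f (i - b j) (T^[b j] z) := by
    rw [← birkhoffSum_add, Nat.add_sub_cancel' hbi]
  calc ‖birkhoffSum T f i z‖
      ≤ ‖birkhoffSum T f N y‖ + (ε * j + D) + (C + 3 * K) * ε * (N + n * j) + K * (2 * n) :=
        hsplit ▸ norm_add_le_of_le hblocks hpartial
    _ ≤ ‖birkhoffSum T f N y‖ + (ε * i + D) + (C + 3 * K) * ε * i + K * (2 * n) := by gcongr
    _ = _ := by ring

end BlockTraces

end Tracing

/-! ### Steering Birkhoff averages -/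

section Steering

variable {X E : Type*} [NormedAddCommGroup E] [NormedSpace ℝ E]

lemma exists_norm_sum_le_of_tendsto_average {a : ℕ → E}
    (h : Tendsto (fun J : ℕ => (J : ℝ)⁻¹ • ∑ i ∈ Finset.range J, a i) atTop (𝓝 0)) {ε : ℝ}
    (hε : 0 < ε) : ∃ D, ∀ J : ℕ, ‖∑ i ∈ Finset.range J, a i‖ ≤ ε * J + D := by
  have hbdd : IsBoundedUnder (· ≤ ·) atTop
      fun J : ℕ => ‖∑ i ∈ Finset.range J, a i‖ - ε * J := by
    refine ⟨0, eventually_map.2 ?_⟩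
    filter_upwards [h.norm.eventually_lt_const (by simpa using hε), eventually_gt_atTop 0]
      with J hJ hJ₀
    rw [norm_smul, norm_inv, Real.norm_natCast,
      inv_mul_lt_iff₀ (Nat.cast_pos.2 hJ₀)] at hJ
    linarith
  obtain ⟨D, hD⟩ := hbdd.bddAbove_range
  exact ⟨D, fun J => by linarith [hD ⟨J, rfl⟩]⟩

lemma dist_birkhoffAverage {T : X → X} {f : X → E} {n : ℕ} (hn : 0 < n) (x : X) (m : E) :
    dist (birkhoffAverage ℝ T f n x) m = ‖birkhoffSum T (fun y => f y - m) n x‖ / n := by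
  have hn' : (n : ℝ) ≠ 0 := Nat.cast_ne_zero.2 hn.ne'
  have hsum : birkhoffSum T (fun y => f y - m) n x = birkhoffSum T f n x - (n : ℝ) • m := by
    simp [birkhoffSum, Finset.sum_sub_distrib, Nat.cast_smul_eq_nsmul]
  rw [div_eq_inv_mul, ← Real.norm_natCast, ← norm_inv, ← norm_smul, hsum, smul_sub,
    inv_smul_smul₀ hn', dist_eq_norm, birkhoffAverage]

variable [MetricSpace X] {T : X → X} {f : X → E} {C : NNReal} {K : ℝ}

lemma HasSAPS.exists_trace_norm_birkhoffSum_le (h : HasSAPS T) (hfC : LipschitzWith C f)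
    (hfK : ∀ x, ‖f x‖ ≤ K) (hf : IsOrbitApproximable T f 0) {ε : ℝ} (hε : 0 < ε) :
    ∃ L > 0, ∀ y N, L ≤ N → ∀ M, ∃ z N', M ≤ N' ∧ N < N' ∧
      (∀ t < N, dist (T^[t] y) (T^[t] z) < ε) ∧
      ∀ i ∈ Icc N N', ‖birkhoffSum T f i z‖ ≤ ‖birkhoffSum T f N y‖ + ε * i := by
  rcases isEmpty_or_nonempty X with hX | ⟨⟨x₀⟩⟩
  · exact ⟨1, one_pos, fun y => hX.elim y⟩
  have hK : 0 ≤ K := (norm_nonneg _).trans (hfK x₀)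
  let c : ℝ := C + 3 * K + 1
  have hc : 1 ≤ c := le_add_of_nonneg_left (by positivity)
  obtain ⟨η, hη, hη₁, hcη⟩ : ∃ η > 0, η ≤ 1 ∧ c * η ≤ ε / 2 := by
    refine ⟨min 1 (ε / 2 / c), by positivity, min_le_left _ _, ?_⟩
    rw [← le_div_iff₀' (by positivity)]
    exact min_le_right _ _
  have hηε : η ≤ ε := by linarith [le_mul_of_one_le_left hη.le hc]
  obtain ⟨N₀, hN₀⟩ := h.exists_blockTraces hη
  obtain ⟨x, hx⟩ := hf (N₀ + 1)
  rw [smul_zero] at hx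
  obtain ⟨D, hD⟩ := exists_norm_sum_le_of_tendsto_average hx hη
  let B : ℝ := D + K * (2 * (N₀ + 1 : ℕ))
  obtain ⟨L, hL⟩ := exists_nat_ge (B / (ε / 2))
  refine ⟨max L (N₀ + 1), by positivity, fun y N hN M => ?_⟩
  have hNN₀ : N₀ + 1 ≤ N := (le_max_right _ _).trans hN
  obtain ⟨z, b, hz⟩ := hN₀ y x N (N₀ + 1) (M + 1) (by omega) (by omega) (by omega) (by omega)
  have hend : N + (N₀ + 1) * (M + 1) ≤ b (M + 1) := hz.add_mul_le le_rfl
  have hM : M + 1 ≤ (N₀ + 1) * (M + 1) := Nat.le_mul_of_pos_left _ N₀.succ_pos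
  refine ⟨z, b (M + 1), by omega, by omega, fun t ht => (hz.dist_lt t ht).trans_le hηε,
    fun i hi => ?_⟩
  have hB : B ≤ ε / 2 * i := by
    have : (L : ℝ) ≤ i := Nat.cast_le.2 ((le_max_left _ _).trans (hN.trans hi.1))
    rw [← div_le_iff₀' (by positivity)]
    exact hL.trans this
  calc ‖birkhoffSum T f i z‖
      ≤ ‖birkhoffSum T f N y‖ + c * η * i + B :=
        hz.norm_birkhoffSum_le_add hη.le hη₁ N₀.succ_pos hfC hfK hD hi
    _ ≤ ‖birkhoffSum T f N y‖ + ε / 2 * i + ε / 2 * i := by gcongr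
    _ = ‖birkhoffSum T f N y‖ + ε * i := by ring

/-- From the orbit segment `p = (y, N)` to the longer one `q = (z, N')`: the point `z` traces the
first `N` steps of the orbit of `y` within `ε`, and between the times `N` and `N'` the average of
`f` along the orbit of `z` moves, up to `ε`, into the vector `m` without leaving the ball around `m`
in which it starts. -/
structure SteersTo (T : X → X) (f : X → E) (m : E) (ε : ℝ) (p q : X × ℕ) : Prop where
  lt : p.2 < q.2
  dist_lt : ∀ t < p.2, dist (T^[t] p.1) (T^[t] q.1) < ε
  dist_average_le : dist (birkhoffAverage ℝ T f q.2 q.1) m ≤ ε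
  dist_average_le_add : ∀ i ∈ Icc p.2 q.2,
    dist (birkhoffAverage ℝ T f i q.1) m ≤ dist (birkhoffAverage ℝ T f p.2 p.1) m + ε

theorem HasSAPS.exists_steersTo (h : HasSAPS T) (hfC : LipschitzWith C f) (hfK : ∀ x, ‖f x‖ ≤ K)
    {m : E} (hm : IsOrbitApproximable T f m) {ε : ℝ} (hε : 0 < ε) :
    ∃ L > 0, ∀ p : X × ℕ, L ≤ p.2 → ∀ M, ∃ q : X × ℕ, M ≤ q.2 ∧ SteersTo T f m ε p q := by
  let g : X → E := fun x => f x - m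
  have hgC : LipschitzWith C g := fun x y => by simpa [g] using hfC x y
  have hgK (x : X) : ‖g x‖ ≤ K + ‖m‖ := (norm_sub_le _ _).trans (by gcongr; exact hfK x)
  have hg : IsOrbitApproximable T g 0 := by simpa [g] using hm.sub_const m
  obtain ⟨L, hL₀, hL⟩ := h.exists_trace_norm_birkhoffSum_le hgC hgK hg (half_pos hε)
  refine ⟨L, hL₀, fun ⟨y, N⟩ hN M => ?_⟩
  obtain ⟨M', hM'⟩ := exists_nat_ge (‖birkhoffSum T g N y‖ / (ε / 2))
  obtain ⟨z, N', hMN', hNN', htrace, hsum⟩ := hL y N hN (max M M')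
  have hN₀ : 0 < N := hL₀.trans_le hN
  have haverage (i : ℕ) (hi : i ∈ Icc N N') : dist (birkhoffAverage ℝ T f i z) m ≤
      ‖birkhoffSum T g N y‖ / i + ε / 2 := by
    have hi₀ : (0 : ℝ) < i := Nat.cast_pos.2 (hN₀.trans_le hi.1)
    rw [dist_birkhoffAverage (hN₀.trans_le hi.1), div_add' _ _ _ hi₀.ne']
    gcongr
    exact hsum i hi
  refine ⟨(z, N'), (le_max_left _ _).trans hMN', hNN', fun t ht => (htrace t ht).trans ?_, ?_,
    fun i hi => (haverage i hi).trans ?_⟩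
  · linarith
  · have hN'₀ : (0 : ℝ) < N' := Nat.cast_pos.2 (hN₀.trans hNN')
    have : ‖birkhoffSum T g N y‖ / N' ≤ ε / 2 := by
      have : (M' : ℝ) ≤ N' := Nat.cast_le.2 ((le_max_right _ _).trans hMN')
      rw [div_le_comm₀ hN'₀ (by positivity)]
      exact hM'.trans this
    linarith [haverage N' ⟨hNN'.le, le_rfl⟩]
  · rw [dist_birkhoffAverage hN₀]
    have : (N : ℝ) ≤ i := Nat.cast_le.2 hi.1
    have : (0 : ℝ) < N := Nat.cast_pos.2 hN₀
    gcongr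
    linarith

end Steering

/-! ### Following a sequence of targets -/

/-- The sequence `a` follows the sequence of targets `m`: along a subsequence it gets close to
`m 0, m 1, …`, and on its way from `m j` to `m (j + 1)` it stays, up to a small error, in the ball
around `m (j + 1)` through `m j`. -/
def Follows {E : Type*} [PseudoMetricSpace E] (a m : ℕ → E) : Prop :=
  ∃ N : ℕ → ℕ, StrictMono N ∧ ∃ ε : ℕ → ℝ, Tendsto ε atTop (𝓝 0) ∧ ∀ j,
    dist (a (N j)) (m j) ≤ ε j ∧
    ∀ i ∈ Icc (N j) (N (j + 1)), dist (a i) (m (j + 1)) ≤ dist (m j) (m (j + 1)) + ε j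

section FollowsTargets

variable {E : Type*} [PseudoMetricSpace E] {a m : ℕ → E}

lemma mapClusterPt_of_tendsto_dist {β : Type*} {l : Filter β} {b c : β → E} {w : E}
    (hbc : Tendsto (fun i => dist (b i) (c i)) l (𝓝 0)) (hw : MapClusterPt w l b) :
    MapClusterPt w l c := by
  obtain ⟨F, hF, hb⟩ := mapClusterPt_iff_ultrafilter.1 hw
  exact mapClusterPt_iff_ultrafilter.2 ⟨F, hF, (tendsto_iff_of_dist (hbc.mono_left hF)).1 hb⟩

lemma Follows.mapClusterPt (h : Follows a m) {w : E} (hw : MapClusterPt w atTop m) :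
    MapClusterPt w atTop a := by
  obtain ⟨N, hN, ε, hε, hNε⟩ := h
  have hdist : Tendsto (fun j => dist (m j) (a (N j))) atTop (𝓝 0) :=
    squeeze_zero (fun _ => dist_nonneg) (fun j => by rw [dist_comm]; exact (hNε j).1) hε
  exact (mapClusterPt_of_tendsto_dist hdist hw).of_comp (φ := N) hN.tendsto_atTop

/-- The sequence `a` approaches the set `S`: every `r`-neighbourhood of `S` contains a tail of
`a`. -/
def Approaches (a : ℕ → E) (S : Set E) : Prop :=
  ∀ r > 0, ∀ᶠ i in atTop, a i ∈ Metric.thickening r S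

lemma Approaches.mem_closure {S : Set E} (h : Approaches a S) {w : E}
    (hw : MapClusterPt w atTop a) : w ∈ closure S := by
  rw [Metric.closure_eq_iInter_cthickening]
  exact mem_iInter₂.2 fun r hr => Metric.closure_thickening_subset_cthickening r S
    (mem_closure_iff_clusterPt.2 (ClusterPt.mono hw (le_principal_iff.2 (h r hr))))

lemma Follows.approaches (h : Follows a m) {S : Set E} {u : ℕ → E} (huS : ∀ j, u j ∈ S)
    (hu : Tendsto (fun j => dist (u j) (u (j + 1))) atTop (𝓝 0))
    (hmu : Tendsto (fun j => dist (m j) (u j)) atTop (𝓝 0)) : Approaches a S := by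
  intro r hr
  obtain ⟨N, hN, ε, hε, hNε⟩ := h
  have hbound : Tendsto (fun j => dist (m j) (u j) + dist (u j) (u (j + 1)) +
      2 * dist (m (j + 1)) (u (j + 1)) + ε j) atTop (𝓝 0) := by
    simpa using ((hmu.add hu).add
      (((tendsto_add_atTop_iff_nat 1).2 hmu).const_mul 2)).add hε
  obtain ⟨J, hJ⟩ := eventually_atTop.1 (hbound.eventually_lt_const hr)
  refine (eventually_gt_atTop (N J)).mono fun i hi => ?_
  obtain ⟨j, hj, hij⟩ : ∃ j ≥ J, i ∈ Icc (N j) (N (j + 1)) := by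
    obtain ⟨j, hji, hij⟩ := hN.exists_between_of_tendsto_atTop hN.tendsto_atTop
      ((hN.monotone J.zero_le).trans_lt hi)
    exact ⟨j, Nat.lt_succ_iff.1 (hN.lt_iff_lt.1 (hi.trans_le hij)), hji.le, hij⟩
  have h₁ := dist_triangle (a i) (m (j + 1)) (u (j + 1))
  have h₂ := dist_triangle4 (m j) (u j) (u (j + 1)) (m (j + 1))
  rw [dist_comm (u (j + 1))] at h₂
  exact Metric.mem_thickening_iff.2 ⟨u (j + 1), huS _, by linarith [hJ j hj, (hNε j).2 i hij]⟩

end FollowsTargets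

section Limit

variable {X : Type*} [MetricSpace X] {T : X → X}

lemma exists_dist_iterate_le [CompleteSpace X] (hT : Continuous T) {y : ℕ → X} {N : ℕ → ℕ}
    (hN : Monotone N) (hN₀ : 0 < N 0) {r : ℝ}
    (h : ∀ j, ∀ t < N j, dist (T^[t] (y j)) (T^[t] (y (j + 1))) ≤ r / 2 / 2 ^ j) :
    ∃ x, ∀ j, ∀ t < N j, dist (T^[t] (y j)) (T^[t] x) ≤ r / 2 ^ j := by
  obtain ⟨x, hx⟩ := cauchySeq_tendsto_of_complete <|
    cauchySeq_of_le_geometric_two fun j => h j 0 (hN₀.trans_le (hN j.zero_le))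
  refine ⟨x, fun j t ht => ?_⟩
  have hstep (n : ℕ) :
      dist (T^[t] (y (n + j))) (T^[t] (y (n + 1 + j))) ≤ r / 2 ^ j / 2 / 2 ^ n := by
    rw [Nat.add_right_comm]
    refine (h (n + j) t (ht.trans_le (hN (Nat.le_add_left _ _)))).trans_eq ?_
    rw [pow_add]
    field_simp
  have hlim : Tendsto (fun n => T^[t] (y (n + j))) atTop (𝓝 (T^[t] x)) :=
    ((hT.iterate t).tendsto x).comp ((tendsto_add_atTop_iff_nat j).2 hx)
  simpa using dist_le_of_le_geometric_two_of_tendsto₀ hstep hlim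

variable {E : Type*} [NormedAddCommGroup E] [NormedSpace ℝ E] {f : X → E} {C : NNReal} {K : ℝ}

lemma dist_birkhoffAverage_le_of_trace {ε : ℝ} (hε : 0 ≤ ε) (hfC : LipschitzWith C f) {x y : X}
    {n : ℕ} (h : ∀ t < n, dist (T^[t] x) (T^[t] y) ≤ ε) :
    dist (birkhoffAverage ℝ T f n x) (birkhoffAverage ℝ T f n y) ≤ C * ε := by
  rcases n.eq_zero_or_pos with rfl | hn
  · simpa using mul_nonneg C.2 hε
  rw [dist_birkhoffAverage_birkhoffAverage, div_le_iff₀ (by exact_mod_cast hn)]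
  exact dist_birkhoffSum_le_of_trace hfC h

lemma follows_of_steersTo (hfC : LipschitzWith C f) {m : ℕ → E} {p : ℕ → X × ℕ} {ε δ : ℕ → ℝ}
    (hp : ∀ j, SteersTo T f (m j) (ε j) (p j) (p (j + 1))) {x : X}
    (hx : ∀ j, ∀ t < (p j).2, dist (T^[t] (p j).1) (T^[t] x) ≤ δ j)
    (hε : Tendsto ε atTop (𝓝 0)) (hδ : Tendsto δ atTop (𝓝 0)) :
    Follows (fun n => birkhoffAverage ℝ T f n x) m := by
  let A (n : ℕ) (y : X) : E := birkhoffAverage ℝ T f n y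
  have hε₀ (j : ℕ) : 0 ≤ ε j := dist_nonneg.trans (hp j).dist_average_le
  have hδ₀ (j : ℕ) : 0 ≤ δ (j + 1) :=
    dist_nonneg.trans (hx (j + 1) 0 ((Nat.zero_le _).trans_lt (hp j).lt))
  have hCδ (j : ℕ) : 0 ≤ C * δ (j + 1) := mul_nonneg C.2 (hδ₀ j)
  have htrace {i j : ℕ} (hi : i ≤ (p (j + 1)).2) :
      dist (A i x) (A i (p (j + 1)).1) ≤ C * δ (j + 1) := by
    rw [dist_comm]
    exact dist_birkhoffAverage_le_of_trace (hδ₀ j) hfC fun t ht => hx _ t (ht.trans_le hi)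
  refine ⟨fun j => (p (j + 1)).2, strictMono_nat_of_lt_succ fun j => (hp (j + 1)).lt,
    fun j => C * δ (j + 1) + C * δ (j + 2) + ε j + ε (j + 1), ?_, fun j => ⟨?_, fun i hi => ?_⟩⟩
  · simpa using (((((tendsto_add_atTop_iff_nat 1).2 hδ).const_mul (C : ℝ)).add
      (((tendsto_add_atTop_iff_nat 2).2 hδ).const_mul (C : ℝ))).add hε).add
      ((tendsto_add_atTop_iff_nat 1).2 hε)
  · linarith [dist_triangle (A (p (j + 1)).2 x) (A (p (j + 1)).2 (p (j + 1)).1) (m j),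
      htrace (le_refl (p (j + 1)).2), (hp j).dist_average_le, hCδ (j + 1), hε₀ (j + 1)]
  · linarith [dist_triangle (A i x) (A i (p (j + 2)).1) (m (j + 1)), htrace hi.2,
      (hp (j + 1)).dist_average_le_add i hi, hCδ j, (hp j).dist_average_le,
      dist_triangle (A (p (j + 1)).2 (p (j + 1)).1) (m j) (m (j + 1))]

variable {ι : Type*} [TopologicalSpace ι] [DiscreteTopology ι]

lemma HasSAPS.exists_isLocallyConstant_steersTo (h : HasSAPS T) (hfC : LipschitzWith C f)
    (hfK : ∀ x, ‖f x‖ ≤ K) {m : ℕ → ι → E} (hm : ∀ j i, IsOrbitApproximable T f (m j i))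
    {ε : ℕ → ℝ} (hε : ∀ j, 0 < ε j) (x₀ : X) :
    ∃ p : ℕ → (ℕ → ι) → X × ℕ, (∀ j, IsLocallyConstant (p j)) ∧
      ∀ α, (p 0 α).1 = x₀ ∧ 0 < (p 0 α).2 ∧
        ∀ j, SteersTo T f (m j (α j)) (ε j) (p j α) (p (j + 1) α) := by
  have : Nonempty (X × ℕ) := ⟨(x₀, 0)⟩
  choose! L hL₀ q hLq hq using fun j i => h.exists_steersTo hfC hfK (hm j i) (hε j)
  let p : ℕ → (ℕ → ι) → X × ℕ := fun j α => Nat.rec (x₀, L 0 (α 0))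
    (fun j p => q j (α j) p (L (j + 1) (α (j + 1)))) j
  have hLp (α : ℕ → ι) (j : ℕ) : L j (α j) ≤ (p j α).2 := by
    induction j with
    | zero => exact le_rfl
    | succ j ih => exact hLq j (α j) (p j α) ih _
  have hcoord (j : ℕ) : IsLocallyConstant fun α : ℕ → ι => α j :=
    (IsLocallyConstant.iff_continuous _).2 (continuous_apply j)
  refine ⟨p, fun j => ?_, fun α => ⟨rfl, hL₀ 0 (α 0), fun j => hq j (α j) (p j α) (hLp α j) _⟩⟩
  induction j with
  | zero => exact (hcoord 0).comp fun i => (x₀, L 0 i)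
  | succ j ih =>
    exact ((hcoord j).prodMk ((hcoord (j + 1)).prodMk ih)).comp
      fun s => q j s.1 s.2.2 (L (j + 1) s.2.1)

theorem HasSAPS.exists_continuous_follows [CompleteSpace X] (h : HasSAPS T) (hT : Continuous T)
    (hfC : LipschitzWith C f) (hfK : ∀ x, ‖f x‖ ≤ K) {m : ℕ → ι → E}
    (hm : ∀ j i, IsOrbitApproximable T f (m j i)) (x₀ : X) {r : ℝ} (hr : 0 < r) :
    ∃ F : (ℕ → ι) → X, Continuous F ∧ ∀ α, dist x₀ (F α) ≤ r ∧
      Follows (fun n => birkhoffAverage ℝ T f n (F α)) (fun j => m j (α j)) := by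
  obtain ⟨p, hp, hpα⟩ := h.exists_isLocallyConstant_steersTo hfC hfK hm
    (ε := fun j => r / 2 / 2 ^ j) (fun j => by positivity) x₀
  choose hp₀ hp₁ hsteer using hpα
  have hmono (α : ℕ → ι) : StrictMono fun j => (p j α).2 :=
    strictMono_nat_of_lt_succ fun j => (hsteer α j).lt
  have hgeom (c : ℝ) : Tendsto (fun j : ℕ => c / 2 ^ j) atTop (𝓝 0) := by
    have : Tendsto (fun j : ℕ => (2⁻¹ : ℝ) ^ j) atTop (𝓝 0) :=
      tendsto_pow_atTop_nhds_zero_of_lt_one (by norm_num) (by norm_num)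
    simpa [div_eq_mul_inv] using this.const_mul c
  choose F hF using fun α => exists_dist_iterate_le hT (hmono α).monotone (hp₁ α)
    fun j t ht => ((hsteer α j).dist_lt t ht).le
  have hdist (j : ℕ) (α : ℕ → ι) : dist (p j α).1 (F α) ≤ r / 2 ^ j :=
    hF α j 0 ((hp₁ α).trans_le ((hmono α).monotone j.zero_le))
  refine ⟨F, ?_, fun α => ⟨?_, follows_of_steersTo hfC (hsteer α) (hF α) (hgeom _) (hgeom r)⟩⟩
  · refine TendstoUniformly.continuous (F := fun j α => (p j α).1) (p := atTop) ?_
      (.of_forall fun j => ((hp j).comp Prod.fst).continuous)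
    rw [Metric.tendstoUniformly_iff]
    refine fun δ hδ => ((hgeom r).eventually_lt_const hδ).mono fun j hj α => ?_
    rw [dist_comm]
    exact (hdist j α).trans_lt hj
  · simpa [hp₀] using hdist 0 α

end Limit

/-! ### Low levels of the Borel hierarchy -/

section Borel

variable {X : Type*} [TopologicalSpace X]

lemma IsSigma0.isOpen_of_one {A : Set X} (h : IsSigma0 1 A) : IsOpen A := by
  cases h with
  | isOpen _ hA => exact hA
  | iUnion _ n _ hn _ => exact absurd (hn 0) (by omega)

lemma IsSigma0.isGδ_compl_of_two {A : Set X} (h : IsSigma0 2 A) : IsGδ Aᶜ := by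
  cases h with
  | iUnion _ n A hn hA =>
    rw [compl_iUnion]
    refine IsGδ.iInter_of_isOpen fun i => ?_
    obtain hi : n i = 1 := by have := hn i; omega
    exact (hi ▸ hA i).isOpen_of_one

lemma IsSigma0.exists_eq_iUnion_isGδ_of_three [TopologicalSpace.PseudoMetrizableSpace X]
    {A : Set X} (h : IsSigma0 3 A) : ∃ G : ℕ → Set X, (∀ i, IsGδ (G i)) ∧ A = ⋃ i, G i := by
  let _ := TopologicalSpace.pseudoMetrizableSpacePseudoMetric X
  cases h with
  | iUnion _ n A hn hA =>
    refine ⟨A, fun i => ?_, rfl⟩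
    obtain hi | hi : n i = 1 ∨ n i = 2 := by have := hn i; omega
    · exact (isOpen_compl_iff.1 (hi ▸ hA i).isOpen_of_one).isGδ
    · exact compl_compl (A i) ▸ (hi ▸ hA i : IsSigma0 2 (A i)ᶜ).isGδ_compl_of_two

lemma isPi0_two_of_isGδ {A : Set X} (h : IsGδ A) : IsPi0 2 A := by
  obtain ⟨U, hU, rfl⟩ := h.eq_iInter_nat
  rw [IsPi0, compl_iInter]
  refine .iUnion 2 (fun _ => 1) _ (fun _ => by simp) fun i => ?_
  rw [compl_compl]
  exact .isOpen _ (hU i)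

lemma isPi0_three_iInter_iUnion {A : ℕ → ℕ → Set X} (h : ∀ i j, IsClosed (A i j)) :
    IsPi0 3 (⋂ i, ⋃ j, A i j) := by
  rw [IsPi0, compl_iInter]
  refine .iUnion 3 (fun _ => 2) _ (fun _ => by simp) fun i => ?_
  rw [compl_compl]
  exact .iUnion 2 (fun _ => 1) _ (fun _ => by simp) fun j => .isOpen _ (h i j).isOpen_compl

variable {E : Type*} [PseudoMetricSpace E] {a : ℕ → X → E}

lemma isPi0_three_setOf_tendsto (ha : ∀ n, Continuous (a n)) (w : E) :
    IsPi0 3 {x | Tendsto (a · x) atTop (𝓝 w)} := by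
  have : {x | Tendsto (a · x) atTop (𝓝 w)} =
      ⋂ i : ℕ, ⋃ N : ℕ, ⋂ n ≥ N, {x | dist (a n x) w ≤ 1 / (i + 1)} := by
    ext x
    simp [(Metric.nhds_basis_closedBall_inv_nat_succ).tendsto_right_iff]
  rw [this]
  exact isPi0_three_iInter_iUnion fun i N => isClosed_biInter fun n _ =>
    isClosed_le ((ha n).dist continuous_const) continuous_const

lemma isGδ_setOf_mapClusterPt (ha : ∀ n, Continuous (a n)) (w : E) :
    IsGδ {x | MapClusterPt w atTop (a · x)} := by
  have : {x | MapClusterPt w atTop (a · x)} =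
      ⋂ i : ℕ, ⋂ N : ℕ, ⋃ n ≥ N, {x | dist (a n x) w < 1 / (i + 1)} := by
    ext x
    simp [Metric.nhds_basis_ball_inv_nat_succ.mapClusterPt_iff_frequently, frequently_atTop]
  rw [this]
  exact .iInter fun i => .iInter_of_isOpen fun N => isOpen_biUnion fun n _ =>
    isOpen_lt ((ha n).dist continuous_const) continuous_const

lemma isGδ_setOf_forall_mapClusterPt (ha : ∀ n, Continuous (a n)) {S : Set E}
    (hS : TopologicalSpace.IsSeparable S) :
    IsGδ {x | ∀ w ∈ S, MapClusterPt w atTop (a · x)} := by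
  obtain ⟨D, hDS, hD, hSD⟩ := hS.exists_countable_dense_subset
  have : {x | ∀ w ∈ S, MapClusterPt w atTop (a · x)} =
      ⋂ w ∈ D, {x | MapClusterPt w atTop (a · x)} := by
    ext x
    simp only [mem_ofPred_eq, mem_iInter]
    exact ⟨fun h w hw => h w (hDS hw), fun h w hw =>
      closure_minimal h isClosed_setOfPred_clusterPt (hSD hw)⟩
  rw [this]
  exact .biInter hD fun w _ => isGδ_setOf_mapClusterPt ha w

end Borel

/-! ### Category in spaces of sequences of natural numbers -/

section Category

/-- The sequences that agree with `a` before the time `l` and are bounded below by `m` from then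
on. -/
def tailSet (a : ℕ → ℕ) (l m : ℕ) : Set (ℕ → ℕ) :=
  {β | (∀ n < l, β n = a n) ∧ ∀ n ≥ l, m ≤ β n}

variable {a : ℕ → ℕ} {l m : ℕ}

lemma isClosed_tailSet : IsClosed (tailSet a l m) := by
  simp only [tailSet, ofPred_and, ofPred_forall]
  refine .inter (isClosed_biInter fun n _ => ?_) (isClosed_biInter fun n _ => ?_)
  · exact isClosed_eq (continuous_apply n) continuous_const
  · exact isClosed_le continuous_const (continuous_apply n)

lemma tailSet_subset_closure {A : Set (ℕ → ℕ)} {γ : ℕ → ℕ} (hγ : ∀ n, m ≤ γ n)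
    (hA : ∀ β, β =ᶠ[atTop] γ → β ∈ A) : tailSet a l m ⊆ closure (tailSet a l m ∩ A) := by
  intro β hβ
  let splice (L n : ℕ) : ℕ := if n < L then β n else γ n
  have hlim : Tendsto splice atTop (𝓝 β) := tendsto_pi_nhds.2 fun n =>
    tendsto_const_nhds.congr' ((eventually_gt_atTop n).mono fun L hL => (if_pos hL).symm)
  refine mem_closure_of_tendsto hlim ((eventually_ge_atTop l).mono fun L hL => ⟨⟨?_, ?_⟩, ?_⟩)
  · exact fun n hn => (if_pos (hn.trans_le hL)).trans (hβ.1 n hn)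
  · intro n hn
    by_cases hnL : n < L
    · simpa [splice, hnL] using hβ.2 n hn
    · simpa [splice, hnL] using hγ n
  · exact hA _ ((eventually_ge_atTop L).mono fun n hn => if_neg hn.not_gt)

/-- The pairs of a sequence `n ↦ (z n).1` tending to infinity and a modulus `k ↦ (z k).2` of its
divergence. In contrast to the set of the sequences tending to infinity, it is closed. -/
def divergenceSet : Set (ℕ → ℕ × ℕ) :=
  {z | ∀ k n, (z k).2 ≤ n → k ≤ (z n).1}

lemma isClosed_divergenceSet : IsClosed divergenceSet := by
  simp only [divergenceSet, ofPred_forall]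
  refine isClosed_iInter fun k => isClosed_iInter fun n => ?_
  exact (isClosed_discrete {p : ℕ × ℕ | p.1 ≤ n → k ≤ p.2}).preimage
    (f := fun z : ℕ → ℕ × ℕ => ((z k).2, (z n).1)) (by fun_prop)

lemma exists_cylinder_inter_divergenceSet_subset_closure {ι : Type*} [Countable ι]
    {G : ι → Set (ℕ → ℕ)} (hG : ∀ α : ℕ → ℕ, Tendsto α atTop atTop → α ∈ ⋃ i, G i) :
    ∃ i, ∃ z ∈ divergenceSet, ∃ k, PiNat.cylinder z k ∩ divergenceSet ⊆
      closure (divergenceSet ∩ {z | (fun n => (z n).1) ∈ G i}) := by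
  have := isClosed_divergenceSet.isCompletelyMetrizableSpace
  have : Nonempty divergenceSet := ⟨⟨fun n => (n, n), fun _ _ => id⟩⟩
  let A (i : ι) : Set (ℕ → ℕ × ℕ) := {z | (fun n => (z n).1) ∈ G i}
  obtain ⟨i, z, hz⟩ := nonempty_interior_of_iUnion_of_closed
    (f := fun i => closure (Subtype.val ⁻¹' A i : Set divergenceSet))
    (fun i => isClosed_closure) <| eq_univ_of_forall fun z => by
      obtain ⟨i, hi⟩ := mem_iUnion.1 <| hG (fun n => (z.1 n).1) <|
        tendsto_atTop_atTop.2 fun k => ⟨(z.1 k).2, fun n hn => z.2 k n hn⟩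
      exact mem_iUnion_of_mem i (subset_closure hi)
  obtain ⟨U, hU, hUA⟩ := isOpen_induced_iff.1
    (isOpen_interior (s := closure (Subtype.val ⁻¹' A i : Set divergenceSet)))
  obtain ⟨_, ⟨y, k, rfl⟩, hzy, hyU⟩ := (PiNat.isTopologicalBasis_cylinders
    fun _ => ℕ × ℕ).exists_subset_of_mem_open (show z.1 ∈ U from hUA.ge hz) hU
  refine ⟨i, z, z.2, k, fun z' ⟨hz'k, hz'⟩ => ?_⟩
  have : (⟨z', hz'⟩ : divergenceSet) ∈ closure (Subtype.val ⁻¹' A i) :=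
    interior_subset (hUA.le (hyU ((PiNat.mem_cylinder_iff_eq.1 hzy) ▸ hz'k)))
  rwa [closure_subtype, Subtype.image_preimage_coe] at this

lemma exists_tailSet_subset_closure {ι : Type*} [Countable ι] {G : ι → Set (ℕ → ℕ)}
    (hG : ∀ α : ℕ → ℕ, Tendsto α atTop atTop → α ∈ ⋃ i, G i) :
    ∃ i a l m, a ∈ tailSet a l m ∧ tailSet a l m ⊆ closure (tailSet a l m ∩ G i) := by
  obtain ⟨i, z, hz, m, hm⟩ := exists_cylinder_inter_divergenceSet_subset_closure hG
  obtain ⟨l, hml, hl⟩ : ∃ l ≥ m + 1, ∀ k ≤ m, (z k).2 ≤ l := by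
    refine ⟨(Finset.range (m + 1)).sup (fun k => (z k).2) + (m + 1), Nat.le_add_left _ _,
      fun k hk => le_add_right (Finset.le_sup (f := fun k => (z k).2) ?_)⟩
    exact Finset.mem_range_succ_iff.2 hk
  let a (n : ℕ) : ℕ := (z n).1
  refine ⟨i, a, l, m, ⟨fun _ _ => rfl, fun n hn => hz m n ((hl m le_rfl).trans hn)⟩, ?_⟩
  have htendsto : tailSet a l m ∩ {β | Tendsto β atTop atTop} ⊆
      closure (tailSet a l m ∩ G i) := by
    rintro β ⟨hβ, hβ'⟩
    choose μ hμ using tendsto_atTop_atTop.1 hβ'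
    let y (n : ℕ) : ℕ × ℕ := (β n, if n ≤ m then (z n).2 else μ n)
    have hy : y ∈ divergenceSet := by
      intro k n hn
      by_cases hk : k ≤ m
      · simp only [y, if_pos hk] at hn
        rcases lt_or_ge n l with hnl | hnl
        · exact (hz k n hn).trans_eq (hβ.1 n hnl).symm
        · exact hk.trans (hβ.2 n hnl)
      · exact hμ k n (by simpa [y, hk] using hn)
    have hyz : y ∈ PiNat.cylinder z m := fun n hn =>
      Prod.ext (hβ.1 n (by omega)) (if_pos hn.le)
    refine map_mem_closure (f := fun (z' : ℕ → ℕ × ℕ) n => (z' n).1) (by fun_prop)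
      ((PiNat.isOpen_cylinder _ y l).inter_closure ⟨PiNat.self_mem_cylinder y l, hm ⟨hyz, hy⟩⟩)
      fun z' ⟨hz'y, hz', hz'G⟩ => ⟨⟨fun n hn => ?_, fun n hn => hz' m n ?_⟩, hz'G⟩
    · exact (congrArg Prod.fst (hz'y n hn)).trans (hβ.1 n hn)
    · rw [hz'y m (by omega)]
      simpa [y] using (hl m le_rfl).trans hn
  have := tailSet_subset_closure (a := a) (l := l) (A := {β | Tendsto β atTop atTop})
    (fun n => le_max_right n m) fun β hβ => (tendsto_atTop_mono (fun n => le_max_left n m)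
      tendsto_id).congr' hβ.symm
  exact this.trans (closure_minimal htendsto isClosed_closure)

lemma exists_frequently_eq_of_tailSet_subset_closure {G : Set (ℕ → ℕ)} (hG : IsGδ G)
    (ha : a ∈ tailSet a l m) (hGa : tailSet a l m ⊆ closure (tailSet a l m ∩ G)) {P : ℕ → Prop}
    (hP : ∃ᶠ j in atTop, P j) : ∃ α ∈ G, ∃ᶠ j in atTop, P j ∧ α j = m := by
  let D : Set (ℕ → ℕ) := {α | ∃ᶠ j in atTop, P j ∧ α j = m}
  have hD : IsGδ D := by
    have : D = ⋂ N, ⋃ j ∈ {j | N ≤ j ∧ P j}, {α : ℕ → ℕ | α j = m} := by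
      ext α
      simp [D, frequently_atTop, and_assoc]
    rw [this]
    exact .iInter_of_isOpen fun N => isOpen_biUnion fun j _ =>
      isOpen_discrete {m} |>.preimage (continuous_apply (A := fun _ => ℕ) j)
  have hDa : tailSet a l m ⊆ closure (tailSet a l m ∩ D) :=
    tailSet_subset_closure (γ := fun _ => m) (fun _ => le_rfl) fun β hβ =>
      hP.and_eventually hβ
  have := (isClosed_tailSet (a := a) (l := l) (m := m)).isCompletelyMetrizableSpace
  have hdense {B : Set (ℕ → ℕ)} (hB : tailSet a l m ⊆ closure (tailSet a l m ∩ B)) :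
      Dense (Subtype.val ⁻¹' B : Set (tailSet a l m)) := by
    rwa [Subtype.dense_iff, Subtype.image_preimage_coe]
  have : Nonempty (tailSet a l m) := ⟨⟨a, ha⟩⟩
  obtain ⟨α, hαG, hαD⟩ := ((hdense hGa).inter_of_Gδ (hG.preimage continuous_subtype_val)
    (hD.preimage continuous_subtype_val) (hdense hDa)).nonempty
  exact ⟨α, hαG, hαD⟩

theorem exists_mem_iUnion_isGδ_frequently_eq {ι : Type*} [Countable ι] {G : ι → Set (ℕ → ℕ)}
    (hG : ∀ i, IsGδ (G i)) (h : ∀ α : ℕ → ℕ, Tendsto α atTop atTop → α ∈ ⋃ i, G i)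
    {P : ℕ → Prop} (hP : ∃ᶠ j in atTop, P j) :
    ∃ α ∈ ⋃ i, G i, ∃ m, ∃ᶠ j in atTop, P j ∧ α j = m := by
  obtain ⟨i, a, l, m, ha, hGa⟩ := exists_tailSet_subset_closure h
  obtain ⟨α, hα, hαm⟩ := exists_frequently_eq_of_tailSet_subset_closure (hG i) ha hGa hP
  exact ⟨α, mem_iUnion_of_mem i hα, m, hαm⟩

end Category

/-! ### Sequences with vanishing steps in connected sets -/

section SlowSequences

lemma exists_path_of_transGen {α : Type*} {r : α → α → Prop} {a b : α}
    (h : Relation.TransGen r a b) :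
    ∃ l > 0, ∃ p : ℕ → α, p 0 = a ∧ p l = b ∧ ∀ i < l, r (p i) (p (i + 1)) := by
  induction h using Relation.TransGen.head_induction_on with
  | @single a hab =>
    refine ⟨1, one_pos, fun | 0 => a | _ + 1 => b, rfl, rfl, fun i hi => ?_⟩
    simpa [Nat.lt_one_iff.1 hi] using hab
  | @head a c hac _ ih =>
    obtain ⟨l, _, p, rfl, rfl, hp⟩ := ih
    refine ⟨l + 1, l.succ_pos, fun | 0 => a | i + 1 => p i, rfl, rfl, fun i hi => ?_⟩
    cases i with
    | zero => exact hac
    | succ i => exact hp i (Nat.succ_lt_succ_iff.1 hi)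

lemma exists_enumeration_blocks {l : ℕ → ℕ} (hl : ∀ n, 0 < l n) :
    ∃ s : ℕ → ℕ × ℕ, Tendsto (fun j => (s j).1) atTop atTop ∧ (∀ n, ∃ j, s j = (n, 0)) ∧
      ∀ j, (s j).2 < l (s j).1 ∧ (s (j + 1) = ((s j).1, (s j).2 + 1) ∨
        (s j).2 + 1 = l (s j).1 ∧ s (j + 1) = ((s j).1 + 1, 0)) := by
  let next (q : ℕ × ℕ) : ℕ × ℕ := if q.2 + 1 < l q.1 then (q.1, q.2 + 1) else (q.1 + 1, 0)
  let s (j : ℕ) : ℕ × ℕ := next^[j] (0, 0)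
  have hs (j : ℕ) : s (j + 1) = next (s j) := Function.iterate_succ_apply' next j (0, 0)
  have hlt (j : ℕ) : (s j).2 < l (s j).1 := by
    cases j with
    | zero => exact hl 0
    | succ j =>
      rw [hs]
      dsimp only [next]
      split_ifs with h
      exacts [h, hl _]
  have hblock {n j : ℕ} (hj : s j = (n, 0)) (i : ℕ) (hi : i < l n) : s (j + i) = (n, i) := by
    induction i with
    | zero => exact hj
    | succ i ih => rw [← add_assoc, hs, ih (by omega)]; exact if_pos hi
  have hstart (n : ℕ) : ∃ j, s j = (n, 0) := by
    induction n with
    | zero => exact ⟨0, rfl⟩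
    | succ n ih =>
      obtain ⟨j, hj⟩ := ih
      have := hl n
      refine ⟨j + (l n - 1) + 1, ?_⟩
      rw [hs, hblock hj _ (by omega)]
      exact if_neg (by dsimp only; omega)
  have hmono : Monotone fun j => (s j).1 := monotone_nat_of_le_succ fun j => by
    rw [hs]
    dsimp only [next]
    split_ifs <;> simp
  refine ⟨s, tendsto_atTop_atTop_of_monotone hmono fun n => ?_, hstart, fun j => ⟨hlt j, ?_⟩⟩
  · obtain ⟨j, hj⟩ := hstart n
    exact ⟨j, by simp [hj]⟩
  · have := hlt j
    rw [hs]
    by_cases h : (s j).2 + 1 < l (s j).1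
    · exact .inl (if_pos h)
    · exact .inr ⟨by omega, if_neg h⟩

variable {E : Type*} [PseudoMetricSpace E] {W : Set E}

lemma exists_path_of_isPreconnected (hW : IsPreconnected W) {ε : ℝ} (hε : 0 < ε) {a b : E}
    (ha : a ∈ W) (hb : b ∈ W) : ∃ l > 0, ∃ p : ℕ → E, p 0 = a ∧ p l = b ∧
      ∀ i < l, p i ∈ W ∧ dist (p i) (p (i + 1)) < ε := by
  refine exists_path_of_transGen (r := fun x y => x ∈ W ∧ dist x y < ε) ?_
  refine hW.induction₂' (Relation.TransGen fun x y => x ∈ W ∧ dist x y < ε) (fun x hx => ?_)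
    (fun _ _ _ _ _ _ => .trans) ha hb
  filter_upwards [self_mem_nhdsWithin, mem_nhdsWithin_of_mem_nhds (Metric.ball_mem_nhds x hε)]
    with y hy hyx
  exact ⟨.single ⟨hx, by rwa [dist_comm]⟩, .single ⟨hy, hyx⟩⟩

lemma exists_slow_sequence (hW : IsPreconnected W) {a : ℕ → E} (ha : ∀ n, a n ∈ W) :
    ∃ u : ℕ → E, (∀ j, u j ∈ W) ∧ Tendsto (fun j => dist (u j) (u (j + 1))) atTop (𝓝 0) ∧
      ∃ N : ℕ → ℕ, Tendsto N atTop atTop ∧ ∀ n, u (N n) = a n := by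
  choose l hl p hp₀ hpl hp using fun n : ℕ =>
    exists_path_of_isPreconnected hW (Nat.one_div_pos_of_nat (α := ℝ) (n := n)) (ha n) (ha (n + 1))
  obtain ⟨s, hs, hs₀, hstep⟩ := exists_enumeration_blocks hl
  choose N hN using hs₀
  have hNinj : Function.Injective N := fun n k h => by
    simpa [hN] using congrArg (fun j => (s j).1) h
  refine ⟨fun j => p (s j).1 (s j).2, fun j => (hp _ _ (hstep j).1).1, ?_, N,
    hNinj.nat_tendsto_atTop, fun n => by simp [hN, hp₀]⟩
  refine squeeze_zero (fun _ => dist_nonneg) (fun j => ?_)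
    ((tendsto_one_div_add_atTop_nhds_zero_nat (𝕜 := ℝ)).comp hs)
  have hnext : p (s (j + 1)).1 (s (j + 1)).2 = p (s j).1 ((s j).2 + 1) := by
    obtain h | ⟨hend, h⟩ := (hstep j).2
    · rw [h]
    · rw [h, hend, hpl, hp₀]
  dsimp only
  rw [hnext]
  exact (hp _ _ (hstep j).1).2.le

lemma exists_seq_forall_frequently_eq {α : Type*} {D : Set α} (hD : D.Countable)
    (hD₀ : D.Nonempty) : ∃ a : ℕ → α, (∀ n, a n ∈ D) ∧ ∀ d ∈ D, ∃ᶠ n in atTop, a n = d := by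
  obtain ⟨e, rfl⟩ := hD.exists_eq_range hD₀
  refine ⟨fun n => e n.unpair.1, fun n => mem_range_self _, ?_⟩
  rintro _ ⟨k, rfl⟩
  exact frequently_atTop.2 fun n => ⟨Nat.pair k n, Nat.right_le_pair k n, by simp⟩

lemma exists_slow_dense_sequence (hW : IsPreconnected W) (hs : TopologicalSpace.IsSeparable W)
    {v : E} (hv : v ∈ W) :
    ∃ u : ℕ → E, (∀ j, u j ∈ W) ∧ Tendsto (fun j => dist (u j) (u (j + 1))) atTop (𝓝 0) ∧
      (∃ᶠ j in atTop, u j = v) ∧ ∀ w ∈ W, MapClusterPt w atTop u := by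
  obtain ⟨D, hDW, hD, hWD⟩ := hs.exists_countable_dense_subset
  obtain ⟨a, haD, ha⟩ := exists_seq_forall_frequently_eq (hD.insert v) (insert_nonempty v D)
  obtain ⟨u, huW, hu, N, hN, huN⟩ :=
    exists_slow_sequence hW fun n => insert_subset hv hDW (haD n)
  have hfreq (d : E) (hd : d ∈ insert v D) : ∃ᶠ j in atTop, u j = d :=
    hN.frequently ((ha d hd).mono fun n hn => (huN n).trans hn)
  refine ⟨u, huW, hu, hfreq v (mem_insert v D), fun w hw => ?_⟩
  refine closure_minimal (fun d hd => ?_) isClosed_setOfPred_clusterPt (hWD hw)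
  refine mapClusterPt_iff_frequently.2 fun U hU => ?_
  exact (hfreq d (mem_insert_of_mem v hd)).mono fun j hj => hj ▸ mem_of_mem_nhds hU

end SlowSequences

lemma exists_mem_inter_closure_diff {Y : Type*} [TopologicalSpace Y] {S V : Set Y}
    (hS : IsPreconnected S) (hV : IsClosed V) (hSV : (S ∩ V).Nonempty) (hSV' : (S \ V).Nonempty) :
    (S ∩ V ∩ closure (S \ V)).Nonempty := by
  rw [inter_assoc]
  refine isPreconnected_closed_iff.1 hS V _ hV isClosed_closure (fun x hx => ?_) hSV ?_
  · by_cases h : x ∈ V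
    exacts [.inl h, .inr (subset_closure ⟨hx, h⟩)]
  · exact hSV'.mono fun x hx => ⟨hx.1, subset_closure hx⟩

section Mixtures

variable {X : Type*} [MetricSpace X] [MeasurableSpace X] [BorelSpace X]
  [TopologicalSpace.SeparableSpace X] {T : X → X}

lemma convex_lipMean_image_invMeasures : Convex ℝ (lipMean '' invMeasures T) := by
  rintro _ ⟨μ, hμ, rfl⟩ _ ⟨ν, hν, rfl⟩ a b ha hb hab
  have hT : Measurable T := MeasurePreserving.measurable hμ
  let κ : Measure X := ENNReal.ofReal a • (μ : Measure X) + ENNReal.ofReal b • (ν : Measure X)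
  have hκ : IsProbabilityMeasure κ := ⟨by simp [κ, ← ENNReal.ofReal_add ha hb, hab]⟩
  have hκT : MeasurePreserving T κ κ := ⟨hT, by
    rw [Measure.map_add _ _ hT, Measure.map_smul, Measure.map_smul,
      MeasurePreserving.map_eq hμ, MeasurePreserving.map_eq hν]⟩
  refine ⟨⟨κ, hκ⟩, hκT, ?_⟩
  calc ∫ x, lipEval x ∂κ = (ENNReal.ofReal a).toReal • lipMean μ +
        (ENNReal.ofReal b).toReal • lipMean ν := by
        rw [integral_add_measure ((integrable_lipEval _).smul_measure ENNReal.ofReal_ne_top)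
          ((integrable_lipEval _).smul_measure ENNReal.ofReal_ne_top), integral_smul_measure,
          integral_smul_measure, lipMean, lipMean]
    _ = a • lipMean μ + b • lipMean ν := by rw [ENNReal.toReal_ofReal ha, ENNReal.toReal_ofReal hb]

lemma isPreconnected_invMeasures : IsPreconnected (invMeasures T) :=
  isInducing_lipMean.isPreconnected_image.1 convex_lipMean_image_invMeasures.isPreconnected

end Mixtures

/-! ### Complexity of the sets of generic points -/

lemma continuous_birkhoffAverage {X E : Type*} [TopologicalSpace X] [NormedAddCommGroup E]
    [NormedSpace ℝ E] {T : X → X} {f : X → E} (hT : Continuous T) (hf : Continuous f) (n : ℕ) :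
    Continuous (birkhoffAverage ℝ T f n) :=
  (continuous_finsetSum _ fun i _ => hf.comp (hT.iterate i)).const_smul (n : ℝ)⁻¹

section Generic

variable {X : Type*} [MetricSpace X] [MeasurableSpace X] [BorelSpace X]
  {T : X → X} {x : X} {μ : ProbabilityMeasure X} {V : Set (ProbabilityMeasure X)}

lemma genericPts_subset_lowerG : genericPts T μ ⊆ lowerG T {μ} :=
  fun _ hx _ hν => eq_of_nhds_neBot (ClusterPt.mono hν hx)

lemma lowerG_subset_compl_meetG_diff (S : Set (ProbabilityMeasure X)) :
    lowerG T V ⊆ (meetG T (S \ V))ᶜ :=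
  fun _ hx ⟨_, hν, _, hνV⟩ => hνV (hx hν)

variable [TopologicalSpace.SeparableSpace X]

lemma mem_limitMeasures_iff :
    μ ∈ limitMeasures T x ↔
      MapClusterPt (lipMean μ) atTop fun n => birkhoffAverage ℝ T lipEval n x := by
  have hshift : map (fun n => birkhoffAverage ℝ T lipEval n x) atTop =
      map lipMean (map (fun n : ℕ => emp T x n.succPNat) atTop) := by
    conv_lhs => rw [← map_add_atTop_eq_nat 1]
    simp only [map_map, Function.comp_def, lipMean_emp, Nat.succPNat_coe, Nat.succ_eq_add_one]
  rw [MapClusterPt, hshift]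
  exact isInducing_lipMean.mapClusterPt_iff.symm

lemma mem_genericPts_iff :
    x ∈ genericPts T μ ↔
      Tendsto (fun n => birkhoffAverage ℝ T lipEval n x) atTop (𝓝 (lipMean μ)) := by
  rw [← tendsto_add_atTop_iff_nat 1]
  refine isInducing_lipMean.tendsto_nhds_iff.trans (tendsto_congr fun n => ?_)
  exact lipMean_emp T x n.succPNat

lemma isPi0_three_genericPts (hT : Continuous T) (μ : ProbabilityMeasure X) :
    IsPi0 3 (genericPts T μ) := by
  convert isPi0_three_setOf_tendsto
    (continuous_birkhoffAverage hT lipschitzWith_lipEval.continuous) (lipMean μ) using 1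
  exact ext fun x => mem_genericPts_iff

lemma isGδ_upperG (hT : Continuous T) (V : Set (ProbabilityMeasure X)) : IsGδ (upperG T V) := by
  convert isGδ_setOf_forall_mapClusterPt
    (continuous_birkhoffAverage hT lipschitzWith_lipEval.continuous)
    (isSeparable_range_lipMean.mono (image_subset_range lipMean V)) using 1
  ext x
  rw [mem_ofPred_eq, forall_mem_image]
  exact forall₂_congr fun μ _ => mem_limitMeasures_iff

/-- The points whose empirical measures accumulate at every measure of `V` and approach `V` in the
bounded Lipschitz metric. The second condition excludes the escape of mass that
`limitMeasures T x ⊆ V` permits, so that `V = {μ}` yields the generic points of `μ`. -/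
def approachG (T : X → X) (V : Set (ProbabilityMeasure X)) : Set X :=
  upperG T V ∩ {x | Approaches (fun n => birkhoffAverage ℝ T lipEval n x) (lipMean '' V)}

lemma approachG_subset_lowerG (hV : IsClosed V) : approachG T V ⊆ lowerG T V := by
  intro x hx μ hμ
  rw [← hV.closure_eq, isInducing_lipMean.closure_eq_preimage_closure_image]
  exact hx.2.mem_closure (mem_limitMeasures_iff.1 hμ)

lemma approachG_singleton_subset_genericPts (μ : ProbabilityMeasure X) :
    approachG T {μ} ⊆ genericPts T μ := by
  intro x hx
  rw [mem_genericPts_iff, Metric.tendsto_nhds]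
  intro ε hε
  simpa [Metric.thickening_singleton] using hx.2 ε hε

lemma mem_approachG_of_follows {u m : ℕ → LipBall X →ᵇ ℝ}
    (h : Follows (fun n => birkhoffAverage ℝ T lipEval n x) m) (huV : ∀ j, u j ∈ lipMean '' V)
    (hu : Tendsto (fun j => dist (u j) (u (j + 1))) atTop (𝓝 0))
    (huc : ∀ w ∈ lipMean '' V, MapClusterPt w atTop u)
    (hmu : Tendsto (fun j => dist (m j) (u j)) atTop (𝓝 0)) : x ∈ approachG T V := by
  refine ⟨fun μ hμ => mem_limitMeasures_iff.2 (h.mapClusterPt ?_), h.approaches huV hu hmu⟩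
  refine mapClusterPt_of_tendsto_dist ?_ (huc _ (mem_image_of_mem _ hμ))
  simpa only [dist_comm] using hmu

lemma exists_slow_dense_sequence_lipMean (hV : IsPreconnected V) (hμ : μ ∈ V) :
    ∃ u : ℕ → LipBall X →ᵇ ℝ, (∀ j, u j ∈ lipMean '' V) ∧
      Tendsto (fun j => dist (u j) (u (j + 1))) atTop (𝓝 0) ∧
      (∃ᶠ j in atTop, u j = lipMean μ) ∧ ∀ w ∈ lipMean '' V, MapClusterPt w atTop u :=
  exists_slow_dense_sequence (hV.image _ continuous_lipMean.continuousOn)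
    (isSeparable_range_lipMean.mono (image_subset_range _ _)) (mem_image_of_mem _ hμ)

lemma isOrbitApproximable_of_mem_image {w : LipBall X →ᵇ ℝ} (hV : V ⊆ invMeasures T)
    (hw : w ∈ lipMean '' V) : IsOrbitApproximable T lipEval w := by
  obtain ⟨μ, hμ, rfl⟩ := hw
  exact isOrbitApproximable_lipMean (hV hμ)

lemma exists_seq_mem_diff_tendsto_lipMean (hVT : V ⊆ invMeasures T) (hVc : IsClosed V)
    (hV : V.Nonempty) (hU : (invMeasures T \ V).Nonempty) :
    ∃ v ∈ V, ∃ e : ℕ → ProbabilityMeasure X, (∀ k, e k ∈ invMeasures T \ V) ∧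
      Tendsto (fun k => lipMean (e k)) atTop (𝓝 (lipMean v)) := by
  obtain ⟨v, hv, hvU⟩ := exists_mem_inter_closure_diff isPreconnected_invMeasures hVc
    (by rwa [inter_eq_right.2 hVT]) hU
  rw [isInducing_lipMean.closure_eq_preimage_closure_image, mem_preimage,
    mem_closure_iff_seq_limit] at hvU
  obtain ⟨y, hy, hyv⟩ := hvU
  choose e he hey using hy
  exact ⟨v, hv.2, e, he, by simpa only [hey] using hyv⟩

variable [CompleteSpace X]

theorem HasSAPS.dense_approachG (h : HasSAPS T) (hT : Continuous T) (hVT : V ⊆ invMeasures T)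
    (hV : IsConnected V) : Dense (approachG T V) := by
  obtain ⟨⟨v, hv⟩, hV⟩ := hV
  obtain ⟨u, huV, hu, -, huc⟩ := exists_slow_dense_sequence_lipMean hV hv
  refine Metric.dense_iff.2 fun x₀ r hr => ?_
  obtain ⟨F, -, hF⟩ := h.exists_continuous_follows (ι := Unit) hT lipschitzWith_lipEval
    norm_lipEval_le (fun j _ => isOrbitApproximable_of_mem_image hVT (huV j)) x₀ (half_pos hr)
  obtain ⟨hdist, hfollows⟩ := hF fun _ => ()
  exact ⟨F fun _ => (), Metric.mem_ball'.2 (hdist.trans_lt (half_lt_self hr)),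
    mem_approachG_of_follows hfollows huV hu huc (by simp)⟩

open Classical in
theorem HasSAPS.exists_continuous_coding (h : HasSAPS T) (hT : Continuous T)
    (hVT : V ⊆ invMeasures T) (hVc : IsClosed V) (hV : IsConnected V)
    (hU : (invMeasures T \ V).Nonempty) :
    ∃ F : (ℕ → ℕ) → X, Continuous F ∧ (∀ α, Tendsto α atTop atTop → F α ∈ approachG T V) ∧
      ∃ P : ℕ → Prop, (∃ᶠ j in atTop, P j) ∧
        ∀ α k, (∃ᶠ j in atTop, P j ∧ α j = k) → F α ∈ meetG T (invMeasures T \ V) := by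
  obtain ⟨v, hv, e, heU, hev⟩ := exists_seq_mem_diff_tendsto_lipMean hVT hVc hV.nonempty hU
  obtain ⟨u, huV, hu, huv, huc⟩ := exists_slow_dense_sequence_lipMean hV.isPreconnected hv
  obtain ⟨x₀⟩ := v.nonempty
  let m (j k : ℕ) : LipBall X →ᵇ ℝ := if u j = lipMean v then lipMean (e k) else u j
  have hm (j k : ℕ) : IsOrbitApproximable T lipEval (m j k) := by
    unfold m
    split_ifs
    exacts [isOrbitApproximable_lipMean (heU k).1, isOrbitApproximable_of_mem_image hVT (huV j)]
  obtain ⟨F, hFc, hF⟩ := h.exists_continuous_follows hT lipschitzWith_lipEval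
    norm_lipEval_le hm x₀ one_pos
  refine ⟨F, hFc, fun α hα => mem_approachG_of_follows (hF α).2 huV hu huc ?_,
    fun j => u j = lipMean v, huv, fun α k hk => ?_⟩
  · refine squeeze_zero (fun _ => dist_nonneg) (fun j => ?_)
      (tendsto_iff_dist_tendsto_zero.1 (hev.comp hα))
    by_cases hj : u j = lipMean v <;> simp [m, hj]
  · refine ⟨e k, mem_limitMeasures_iff.2 ((hF α).2.mapClusterPt ?_), heU k⟩
    refine mapClusterPt_iff_frequently.2 fun s hs => hk.mono fun j ⟨hj, hjk⟩ => ?_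
    simpa [m, hj, hjk] using mem_of_mem_nhds hs

theorem HasSAPS.not_isSigma0_three (h : HasSAPS T) (hT : Continuous T) (hVT : V ⊆ invMeasures T)
    (hVc : IsClosed V) (hV : IsConnected V) (hU : (invMeasures T \ V).Nonempty) {A : Set X}
    (hVA : approachG T V ⊆ A) (hAU : A ⊆ (meetG T (invMeasures T \ V))ᶜ) : ¬ IsSigma0 3 A := by
  intro hA
  obtain ⟨G, hG, rfl⟩ := hA.exists_eq_iUnion_isGδ_of_three
  obtain ⟨F, hF, hFV, P, hP, hFU⟩ := h.exists_continuous_coding hT hVT hVc hV hU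
  obtain ⟨α, hα, k, hk⟩ := exists_mem_iUnion_isGδ_frequently_eq
    (fun i => (hG i).preimage hF)
    (fun α hα => by rw [← preimage_iUnion]; exact hVA (hFV α hα)) hP
  rw [← preimage_iUnion] at hα
  exact hAU hα (hFU α k hk)

theorem HasSAPS.not_isSigma0_two_upperG (h : HasSAPS T) (hT : Continuous T)
    (hVT : V ⊆ invMeasures T) (hV : IsConnected V) (hU : (invMeasures T \ V).Nonempty) :
    ¬ IsSigma0 2 (upperG T V) := by
  intro hσ
  obtain ⟨w, hwT, hwV⟩ := hU
  obtain ⟨v, hv⟩ := hV.nonempty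
  have : Nonempty X := v.nonempty
  have hsub : approachG T {w} ⊆ (upperG T V)ᶜ := fun x hx hxV =>
    hwV (approachG_subset_lowerG isClosed_singleton hx (hxV hv) ▸ hv)
  have hdense : Dense (upperG T V) := (h.dense_approachG hT hVT hV).mono inter_subset_left
  have hdense' : Dense (upperG T V)ᶜ := (h.dense_approachG hT
    (singleton_subset_iff.2 hwT) isConnected_singleton).mono hsub
  obtain ⟨x, hx, hx'⟩ :=
    (hdense.inter_of_Gδ (isGδ_upperG hT V) hσ.isGδ_compl_of_two hdense').nonempty
  exact hx' hx

theorem HasSAPS.dense_meetG (h : HasSAPS T) (hT : Continuous T) {U : Set (ProbabilityMeasure X)}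
    (hUT : U ⊆ invMeasures T) (hU : U.Nonempty) : Dense (meetG T U) := by
  obtain ⟨w, hw⟩ := hU
  exact (h.dense_approachG hT (singleton_subset_iff.2 (hUT hw)) isConnected_singleton).mono
    fun x hx => ⟨w, hx.1 rfl, hw⟩

end Generic

end PolishDyn

end

theorem mainTheorem1 {X : Type*} [MetricSpace X] [CompleteSpace X]
    [TopologicalSpace.SeparableSpace X] [MeasurableSpace X] [BorelSpace X]
    (T : X → X) (hT : Continuous T) (hSAPS : PolishDyn.HasSAPS T) :
    ((PolishDyn.invMeasures T).Nontrivial →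
      ∀ μ ∈ PolishDyn.invMeasures T,
        PolishDyn.IsPi0Complete 3 (PolishDyn.genericPts T μ)) ∧
    (∀ V U : Set (ProbabilityMeasure X), V ⊆ PolishDyn.invMeasures T → V.Nonempty →
      IsClosed V → IsConnected V → U = PolishDyn.invMeasures T \ V → U.Nonempty →
        PolishDyn.IsPi0Hard 3 (PolishDyn.lowerG T V) ∧
        PolishDyn.IsPi0Hard 3 (PolishDyn.genericG T V) ∧
        PolishDyn.IsSigma0Hard 3 (PolishDyn.meetG T U) ∧
        PolishDyn.IsPi0Complete 2 (PolishDyn.upperG T V) ∧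
        Dense (PolishDyn.lowerG T V) ∧ Dense (PolishDyn.upperG T V) ∧
        Dense (PolishDyn.genericG T V) ∧ Dense (PolishDyn.meetG T U)) := by
  open PolishDyn in
  refine ⟨fun hnt μ hμ => ⟨isPi0_three_genericPts hT μ, ?_⟩, ?_⟩
  · obtain ⟨ν, hν, hνμ⟩ := hnt.exists_ne μ
    exact hSAPS.not_isSigma0_three hT (singleton_subset_iff.2 hμ) isClosed_singleton
      isConnected_singleton ⟨ν, hν, hνμ⟩ (approachG_singleton_subset_genericPts μ)
      (genericPts_subset_lowerG.trans (lowerG_subset_compl_meetG_diff _))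
  · rintro V U hVT - hVc hV rfl hU
    have hdense := hSAPS.dense_approachG hT hVT hV
    have hlower : approachG T V ⊆ lowerG T V := approachG_subset_lowerG hVc
    have hgeneric : approachG T V ⊆ genericG T V := subset_inter inter_subset_left hlower
    have hdisj := lowerG_subset_compl_meetG_diff (T := T) (V := V) (invMeasures T)
    have hard {A : Set X} := hSAPS.not_isSigma0_three hT hVT hVc hV hU (A := A)
    exact ⟨hard hlower hdisj, hard hgeneric (inter_subset_right.trans hdisj),
      hard (hlower.trans hdisj) subset_rfl,
      ⟨isPi0_two_of_isGδ (isGδ_upperG hT V), hSAPS.not_isSigma0_two_upperG hT hVT hV hU⟩,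
      hdense.mono hlower, hdense.mono inter_subset_left, hdense.mono hgeneric,
      hSAPS.dense_meetG hT sdiff_subset hU⟩
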